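/- Let $A\subseteq\mathbb{R}^2$ (the paper) be star-shaped about the origin, with the origin in its interior. A single-vertex crease pattern on $A$ is a finite set $C$ of more than two creases; each crease is the part in $A$ of a ray from the origin, and different creases lie on different rays. The faces of $C$ are the connected components of the complement in $A$ of the creases. A rigid folding of $(A,C)$ is an injective continuous map $f:A\to\mathbb{R}^3$ that is an isometry on each face. The folding angle of $f$ at a crease is the signed angle in $(-\pi,\pi)$ by which the two adjacent faces deviate from a flat plane; it is positive at a valley and negative at a mountain. Let $\mu:C\to\{M,V\}$ be a mountain-valley assignment. Call $(C,\mu)$ rigidly foldable if it has a rigid folding in which the folding angle is negative at every crease $c$ with $\mu(c)=M$ and positive at every crease $c$ with $\mu(c)=V$; call such a rigid folding a folded state of $(C,\mu)$. Call $(C,\mu)$ continuously rigidly foldable if there is a family $(f_t)_{t\in[0,1]}$ of rigid foldings of $(A,C)$, with $f_t(x)$ continuous in $(t,x)\in[0,1]\times A$, such that all folding angles of $f_0$ are zero and $f_1$ is a folded state of $(C,\mu)$. Let $c'\notin C$ be any further crease from the origin, and let $\nu:C\cup\{c'\}\to\{M,V\}$ be an extension of $\mu$, with $\nu(c')$ either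 $M$ or $V$. If $(C,\mu)$ is continuously rigidly foldable, then so is $(C\cup\{c'\},\nu)$. Likewise, if $(C,\mu)$ is rigidly foldable, then so is $(C\cup\{c'\},\nu)$. -/

import Mathlib

namespace Origami

/-- Euclidean three-space, in which the paper is folded. The unfolded paper lies in the
Euclidean plane `ℂ`, with the vertex of the crease pattern at the origin. -/
abbrev Space : Type := EuclideanSpace ℝ (Fin 3)

/-- The label of a crease: mountain or valley. -/
inductive MV : Type
  | mountain : MV
  | valley : MV

/-- The ray from the vertex in direction `c`; the crease with direction `c` is the part of this
ray that lies in the paper. -/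
def ray (c : Circle) : Set ℂ := {z | ∃ r : ℝ, 0 ≤ r ∧ z = (r : ℂ) * (c : ℂ)}

/-- The union of the crease lines of the crease pattern with set of directions `C`. -/
def creaseLines (C : Set Circle) : Set ℂ := ⋃ c ∈ C, ray c

/-- The faces of the crease pattern `C` on the paper `A`: the connected components of the
complement of the crease lines. -/
def IsFace (A : Set ℂ) (C : Set Circle) (S : Set ℂ) : Prop :=
  ∃ x ∈ A \ creaseLines C, S = connectedComponentIn (A \ creaseLines C) x

/-- A rigid folding of the paper `A` with crease pattern `C`: an injective continuous map to
space that is an isometry (for the Euclidean distances) on each face. Such a map is automatically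
differentiable in the interior of `A` off the crease lines. -/
structure IsRigidFolding (A : Set ℂ) (C : Set Circle) (f : ℂ → Space) : Prop where
  continuousOn : ContinuousOn f A
  injOn : Set.InjOn f A
  isometry_face : ∀ S : Set ℂ, IsFace A C S → ∀ x ∈ S, ∀ y ∈ S, dist (f x) (f y) = dist x y

/-- `f` has folding angle `θ` at the crease `c`. Here `L` and `R` are the linear parts of `f` on the
two faces adjacent to `c`, `L` just counterclockwise and `R` just clockwise of `c`. The image of
the counterclockwise face arises from the flat continuation of the clockwise face by rotation
through `θ` about the image of `c`. With the upper side of the paper the one from which it is seen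
with its given orientation, `θ` is positive if the upper sides of the two faces are turned
towards each other (valley), and negative if they are turned away from each other (mountain). -/
def HasFoldingAngle (A : Set ℂ) (f : ℂ → Space) (c : Circle) (θ : ℝ) : Prop :=
  ∃ L R : ℂ →ₗᵢ[ℝ] Space,
    (∃ ε : ℝ, 0 < ε ∧ ∀ x ∈ A,
      (0 < Complex.arg (x / (c : ℂ)) → Complex.arg (x / (c : ℂ)) < ε → f x = f 0 + L x) ∧
      (-ε < Complex.arg (x / (c : ℂ)) → Complex.arg (x / (c : ℂ)) < 0 → f x = f 0 + R x)) ∧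
    -Real.pi < θ ∧ θ ≤ Real.pi ∧
    Real.cos θ = inner ℝ (R (Complex.I * (c : ℂ))) (L (Complex.I * (c : ℂ))) ∧
    Real.sin θ = Matrix.det (Matrix.of ![(R (c : ℂ)).ofLp, (R (Complex.I * (c : ℂ))).ofLp,
      (L (Complex.I * (c : ℂ))).ofLp])

/-- A folding angle of the sign prescribed by the label: positive for a valley, negative for a
mountain. -/
def MV.Allows : MV → ℝ → Prop
  | MV.mountain, θ => θ < 0
  | MV.valley, θ => 0 < θ

/-- All creases are unfolded in `f`. -/
def IsUnfolded (A : Set ℂ) (C : Set Circle) (f : ℂ → Space) : Prop :=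
  ∀ c ∈ C, HasFoldingAngle A f c 0

/-- All creases of `C` are folded in `f`, as mountains and valleys according to `μ`. Only the
values of `μ` on `C` matter. -/
def IsFoldedAs (A : Set ℂ) (C : Set Circle) (μ : Circle → MV) (f : ℂ → Space) : Prop :=
  ∀ c ∈ C, ∃ θ : ℝ, HasFoldingAngle A f c θ ∧ (μ c).Allows θ

/-- `(C, μ)` has a rigid folding in which all creases have non-zero folding angles, with the signs
given by `μ`. -/
def RigidlyFoldable (A : Set ℂ) (C : Set Circle) (μ : Circle → MV) : Prop :=
  ∃ f : ℂ → Space, IsRigidFolding A C f ∧ IsFoldedAs A C μ f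

/-- `(C, μ)` can be folded in a continuously parameterized family of rigid foldings that starts in
the unfolded state and ends in a state in which all creases have non-zero folding angles, with the
signs given by `μ`. -/
def ContinuouslyRigidlyFoldable (A : Set ℂ) (C : Set Circle) (μ : Circle → MV) : Prop :=
  ∃ F : ℝ → ℂ → Space,
    ContinuousOn (fun p : ℝ × ℂ => F p.1 p.2) (Set.Icc (0 : ℝ) 1 ×ˢ A) ∧
    (∀ t ∈ Set.Icc (0 : ℝ) 1, IsRigidFolding A C (F t)) ∧
    IsUnfolded A C (F 0) ∧
    IsFoldedAs A C μ (F 1)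

end Origami

namespace Origami

open scoped Matrix Topology

/-! Cut the folded paper along the new crease `c'`, so that it becomes a chain of plane sectors
hinged at the old creases. Turning three hinges by small angles moves one edge of the cut relative
to the other by a product of three rotations. If the three axes are linearly independent, the
derivative of this product at zero is an isomorphism onto the infinitesimal rotations. By the
inverse function theorem the product can therefore be made a small rotation about the image of `c'`,
in either sense. Then the cut closes up again, and `c'` has become a crease of the desired sign
(`exists_closing`).

Independent axes exist because all creases are folded (`IsConeFolding.exists_independent_creases`).
Suppose that all crease images lay in a plane. At each crease at least one adjacent face leaves this
plane; it can return to it only at the opposite direction, so the next crease on that side is the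
opposite one. More than two creases cannot all have their opposites as creases and a crease-free
half plane beside them.

Small turns keep the signs of the old folding angles by continuity. They keep injectivity by
compactness of the circle: distinct directions stay separated, and nearby ones can collide only if
two neighbouring faces are folded flat onto each other (`IsHinges.eventually_injective`).

Everything is done for the cone over a small circle around the vertex (`cone`), which is a folding
of the whole plane and is restricted to `A` at the end. For continuous foldability, the coned family
is run first, with `c'` unfolded, and the deformation of its last state is appended
(`IsConeFolding.exists_deformation`). -/

/-! ### Vector algebra in space. -/

lemma inner_eq_sum (x y : Space) : inner ℝ x y = x 0 * y 0 + x 1 * y 1 + x 2 * y 2 := by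
  simp [PiLp.inner_apply, Fin.sum_univ_three, mul_comm]

lemma norm_sq_eq_sum (x : Space) : ‖x‖ ^ 2 = x 0 ^ 2 + x 1 ^ 2 + x 2 ^ 2 := by
  rw [← real_inner_self_eq_norm_sq, inner_eq_sum]; ring

/-- The vector product in space, as a continuous linear map in the second argument. -/
noncomputable def cross (u : Space) : Space →L[ℝ] Space :=
  LinearMap.toContinuousLinearMap
    { toFun := fun x => WithLp.toLp 2 (u.ofLp ⨯₃ x.ofLp)
      map_add' := fun x y => by simp
      map_smul' := fun r x => by simp }

lemma cross_apply_zero (u x : Space) : cross u x 0 = u 1 * x 2 - u 2 * x 1 := by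
  simp [cross, _root_.cross_apply]

lemma cross_apply_one (u x : Space) : cross u x 1 = u 2 * x 0 - u 0 * x 2 := by
  simp [cross, _root_.cross_apply]

lemma cross_apply_two (u x : Space) : cross u x 2 = u 0 * x 1 - u 1 * x 0 := by
  simp [cross, _root_.cross_apply]

lemma ext_three {x y : Space} (h0 : x 0 = y 0) (h1 : x 1 = y 1) (h2 : x 2 = y 2) : x = y := by
  ext i; fin_cases i <;> assumption

lemma cross_add_left (u w x : Space) : cross (u + w) x = cross u x + cross w x := by
  apply ext_three <;>
    simp only [cross_apply_zero, cross_apply_one, cross_apply_two, PiLp.add_apply] <;> ring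

lemma cross_smul_left (a : ℝ) (u x : Space) : cross (a • u) x = a • cross u x := by
  apply ext_three <;>
    simp only [cross_apply_zero, cross_apply_one, cross_apply_two, PiLp.smul_apply,
      smul_eq_mul] <;> ring

lemma cross_self (u : Space) : cross u u = 0 := by
  apply ext_three <;>
    simp only [cross_apply_zero, cross_apply_one, cross_apply_two, PiLp.zero_apply] <;> ring

lemma inner_cross_rotate (u v w : Space) :
    inner ℝ u (cross v w) = inner ℝ v (cross w u) := by
  simp only [inner_eq_sum, cross_apply_zero, cross_apply_one, cross_apply_two]; ring

lemma inner_cross_swap (u v w : Space) :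
    inner ℝ u (cross v w) = - inner ℝ u (cross w v) := by
  simp only [inner_eq_sum, cross_apply_zero, cross_apply_one, cross_apply_two]; ring

lemma inner_self_cross (u x : Space) : inner ℝ u (cross u x) = 0 := by
  simp only [inner_eq_sum, cross_apply_zero, cross_apply_one, cross_apply_two]; ring

lemma inner_cross_self (u x : Space) : inner ℝ x (cross u x) = 0 := by
  simp only [inner_eq_sum, cross_apply_zero, cross_apply_one, cross_apply_two]; ring

lemma norm_cross_sq (u x : Space) :
    ‖cross u x‖ ^ 2 = ‖u‖ ^ 2 * ‖x‖ ^ 2 - inner ℝ u x ^ 2 := by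
  simp only [norm_sq_eq_sum, inner_eq_sum, cross_apply_zero, cross_apply_one, cross_apply_two]
  ring

/-- Gram's determinant for an orthonormal pair: a vector is determined by its components. -/
lemma norm_sq_eq_of_orthonormal {v n : Space} (hv : ‖v‖ = 1) (hn : ‖n‖ = 1)
    (hvn : inner ℝ v n = 0) (x : Space) :
    ‖x‖ ^ 2 = inner ℝ v x ^ 2 + inner ℝ n x ^ 2 + inner ℝ (cross v n) x ^ 2 := by
  have hm : ‖cross v n‖ ^ 2 = 1 := by rw [norm_cross_sq, hv, hn, hvn]; norm_num
  have h1 := norm_cross_sq (cross v n) x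
  -- The claim compares two values of the squared norm of this vector: `h1` by the norm formula for
  -- the product, `h3` by its components along `v` and `n`.
  have h2 : cross (cross v n) x = (inner ℝ v x : ℝ) • n - (inner ℝ n x : ℝ) • v := by
    apply ext_three <;>
      simp only [cross_apply_zero, cross_apply_one, cross_apply_two, PiLp.sub_apply,
        PiLp.smul_apply, smul_eq_mul, inner_eq_sum] <;> ring
  have h3 : ‖(inner ℝ v x : ℝ) • n - (inner ℝ n x : ℝ) • v‖ ^ 2
      = inner ℝ v x ^ 2 + inner ℝ n x ^ 2 := by
    rw [@norm_sub_sq_real, norm_smul, norm_smul, hv, hn, inner_smul_left, inner_smul_right,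
      real_inner_comm v n, hvn]
    simp
  rw [h2, h3, hm] at h1
  linarith

/-- The determinant of three vectors in space. -/
noncomputable def det3 (a b c : Space) : ℝ := Matrix.det (Matrix.of ![a.ofLp, b.ofLp, c.ofLp])

lemma det3_eq (a b c : Space) : det3 a b c = inner ℝ a (cross b c) := by
  simp only [det3, inner_eq_sum, cross_apply_zero, cross_apply_one, cross_apply_two,
    Matrix.det_fin_three]
  simp
  ring

@[fun_prop]
lemma continuous_cross {X : Type*} [TopologicalSpace X] {f g : X → Space} (hf : Continuous f)
    (hg : Continuous g) : Continuous fun x => cross (f x) (g x) := by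
  have h : ∀ x, cross (f x) (g x) = WithLp.toLp 2 ![f x 1 * g x 2 - f x 2 * g x 1,
      f x 2 * g x 0 - f x 0 * g x 2, f x 0 * g x 1 - f x 1 * g x 0] := fun x => by
    apply ext_three <;> simp [cross_apply_zero, cross_apply_one, cross_apply_two]
  simp only [h]
  refine (PiLp.continuous_toLp 2 _).comp (continuous_pi fun i => ?_)
  fin_cases i <;> simp <;> fun_prop

@[fun_prop]
lemma continuous_det3 {X : Type*} [TopologicalSpace X] {f g h : X → Space} (hf : Continuous f)
    (hg : Continuous g) (hh : Continuous h) : Continuous fun x => det3 (f x) (g x) (h x) := by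
  simp only [det3_eq]
  fun_prop

/-! ### Rotations and products of three rotations. -/

/-- Rotation of space about the unit vector `u` through the angle `t`. -/
noncomputable def rot (u : Space) (t : ℝ) : Space →L[ℝ] Space :=
  Real.cos t • ContinuousLinearMap.id ℝ Space + Real.sin t • cross u +
    (1 - Real.cos t) • (innerSL ℝ u).smulRight u

lemma rot_apply (u : Space) (t : ℝ) (x : Space) : rot u t x =
    Real.cos t • x + Real.sin t • cross u x + ((1 - Real.cos t) * inner ℝ u x) • u := by
  simp [rot, smul_smul]

@[simp] lemma rot_zero (u x : Space) : rot u 0 x = x := by simp [rot_apply]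

lemma rot_self {u : Space} (hu : ‖u‖ = 1) (t : ℝ) : rot u t u = u := by
  rw [rot_apply, cross_self, real_inner_self_eq_norm_sq, hu, smul_zero, add_zero, ← add_smul]
  norm_num

lemma norm_rot {u : Space} (hu : ‖u‖ = 1) (t : ℝ) (x : Space) : ‖rot u t x‖ = ‖x‖ := by
  rw [← sq_eq_sq₀ (norm_nonneg _) (norm_nonneg _), rot_apply, @norm_add_sq_real,
    @norm_add_sq_real, inner_add_left]
  simp only [norm_smul, inner_smul_left, inner_smul_right, mul_pow, norm_cross_sq, hu,
    inner_cross_self]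
  rw [real_inner_comm u (cross u x), inner_self_cross, real_inner_comm u x]
  simp only [Real.norm_eq_abs, sq_abs, RCLike.conj_to_real, mul_pow]
  linear_combination (‖x‖ ^ 2 - inner ℝ u x ^ 2) * Real.sin_sq_add_cos_sq t

/-- The composition of rotations about three axes. -/
noncomputable def rot3 (u : Fin 3 → Space) (θ : Fin 3 → ℝ) : Space →L[ℝ] Space :=
  rot (u 0) (θ 0) ∘L rot (u 1) (θ 1) ∘L rot (u 2) (θ 2)

lemma rot3_apply (u : Fin 3 → Space) (θ : Fin 3 → ℝ) (x : Space) :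
    rot3 u θ x = rot (u 0) (θ 0) (rot (u 1) (θ 1) (rot (u 2) (θ 2) x)) := rfl

@[simp] lemma rot3_zero (u : Fin 3 → Space) (x : Space) : rot3 u 0 x = x := by
  simp [rot3_apply]

lemma norm_rot3 {u : Fin 3 → Space} (hu : ∀ i, ‖u i‖ = 1) (θ : Fin 3 → ℝ) (x : Space) :
    ‖rot3 u θ x‖ = ‖x‖ := by
  simp [rot3_apply, norm_rot, hu]

lemma contDiff_rot (u : Space) {X : Type*} [NormedAddCommGroup X] [NormedSpace ℝ X]
    {t : X → ℝ} {x : X → Space} (ht : ContDiff ℝ 1 t) (hx : ContDiff ℝ 1 x) :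
    ContDiff ℝ 1 fun p => rot u (t p) (x p) := by
  simp only [rot_apply]
  have hi : ContDiff ℝ 1 fun p => inner ℝ u (x p) := contDiff_const.inner ℝ hx
  have hk : ContDiff ℝ 1 fun p => cross u (x p) := (cross u).contDiff.comp hx
  fun_prop

lemma continuous_rot (u : Space) {X : Type*} [TopologicalSpace X]
    {t : X → ℝ} {x : X → Space} (ht : Continuous t) (hx : Continuous x) :
    Continuous fun p => rot u (t p) (x p) := by
  simp only [rot_apply]
  fun_prop

@[fun_prop]
lemma continuous_rot3 (u : Fin 3 → Space) {X : Type*} [TopologicalSpace X]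
    {θ : X → Fin 3 → ℝ} {x : X → Space} (hθ : Continuous θ) (hx : Continuous x) :
    Continuous fun p => rot3 u (θ p) (x p) := by
  simp only [rot3_apply]
  exact continuous_rot _ (by fun_prop)
    (continuous_rot _ (by fun_prop) (continuous_rot _ (by fun_prop) hx))

lemma contDiff_rot3 (u : Fin 3 → Space) (x : Space) :
    ContDiff ℝ 1 fun θ : Fin 3 → ℝ => rot3 u θ x := by
  simp only [rot3_apply]
  exact contDiff_rot _ (by fun_prop)
    (contDiff_rot _ (by fun_prop) (contDiff_rot _ (by fun_prop) contDiff_const))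

lemma hasDerivAt_rot_mul (u : Space) (a : ℝ) {z : ℝ → Space} {z' : Space}
    (hz : HasDerivAt z z' 0) :
    HasDerivAt (fun t => rot u (t * a) (z t)) (cross (a • u) (z 0) + z') 0 := by
  simp only [rot_apply]
  have h0 : HasDerivAt (fun t : ℝ => t * a) a 0 := by
    simpa using (hasDerivAt_id (0 : ℝ)).mul_const a
  have hc := h0.cos
  have hs := h0.sin
  have hi : HasDerivAt (fun t => inner ℝ u (z t)) (inner ℝ u z') 0 := by
    simpa using (hasDerivAt_const (0 : ℝ) u).inner ℝ hz
  have hk : HasDerivAt (fun t => cross u (z t)) (cross u z') 0 :=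
    (cross u).hasFDerivAt.comp_hasDerivAt (0 : ℝ) hz
  have := ((hc.smul hz).add (hs.smul hk)).add
    (((hasDerivAt_const (0 : ℝ) (1 : ℝ)).sub hc |>.mul hi).smul_const u)
  refine HasDerivAt.congr_deriv this ?_
  simp [cross_smul_left, add_comm]

/-- To first order rotations commute and their rotation vectors add up. -/
lemma hasDerivAt_rot3_line (u : Fin 3 → Space) (θ : Fin 3 → ℝ) (x : Space) :
    HasDerivAt (fun t : ℝ => rot3 u (t • θ) x) (cross (∑ i, θ i • u i) x) 0 := by
  simp only [rot3_apply, Pi.smul_apply, smul_eq_mul]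
  convert hasDerivAt_rot_mul (u 0) (θ 0) (hasDerivAt_rot_mul (u 1) (θ 1)
    (hasDerivAt_rot_mul (u 2) (θ 2) (hasDerivAt_const (0 : ℝ) x))) using 1
  simp [Fin.sum_univ_three, cross_add_left, add_assoc]

/-! ### Closing the cut: the inverse function theorem at the unbent state. -/

/-- The two orthogonality conditions leave only `v` and `-v`; positivity selects `v`. This lets two
equations express that a rotation fixes `v`. -/
lemma eq_of_inner_pos_of_orthogonal {v n y : Space} (hv : ‖v‖ = 1) (hn : ‖n‖ = 1)
    (hvn : inner ℝ v n = 0) (hy : ‖y‖ = 1) (h0 : 0 < inner ℝ v y) (h1 : inner ℝ n y = 0)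
    (h2 : inner ℝ (cross v n) y = 0) : y = v := by
  have h := norm_sq_eq_of_orthonormal hv hn hvn y
  rw [hy, h1, h2] at h
  have h3 : inner ℝ v y = 1 := by nlinarith
  exact ((inner_eq_one_iff_of_norm_eq_one hv hy).1 h3).symm

/-- The equations for a rotation `rot3 u θ` to fix `v`, together with its sine on the plane
orthogonal to `v`. -/
noncomputable def closingMap (u : Fin 3 → Space) (v n : Space) (θ : Fin 3 → ℝ) : Fin 3 → ℝ :=
  ![inner ℝ (cross v n) (rot3 u θ n), inner ℝ (cross v n) (rot3 u θ v), inner ℝ n (rot3 u θ v)]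

lemma contDiff_closingMap (u : Fin 3 → Space) (v n : Space) :
    ContDiff ℝ 1 (closingMap u v n) := by
  refine contDiff_pi.2 fun i => ?_
  fin_cases i
  · exact contDiff_const.inner ℝ (contDiff_rot3 u n)
  · exact contDiff_const.inner ℝ (contDiff_rot3 u v)
  · exact contDiff_const.inner ℝ (contDiff_rot3 u v)

lemma fderiv_closingMap (u : Fin 3 → Space) (v n : Space) (θ : Fin 3 → ℝ) :
    fderiv ℝ (closingMap u v n) 0 θ =
      ![inner ℝ (cross v n) (cross (∑ i, θ i • u i) n),
        inner ℝ (cross v n) (cross (∑ i, θ i • u i) v), inner ℝ n (cross (∑ i, θ i • u i) v)] := by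
  have h1 : HasDerivAt (fun t : ℝ => closingMap u v n (t • θ))
      (fderiv ℝ (closingMap u v n) 0 θ) 0 := by
    have hd : HasFDerivAt (closingMap u v n) (fderiv ℝ (closingMap u v n) 0) ((0 : ℝ) • θ) := by
      rw [zero_smul]
      exact ((contDiff_closingMap u v n).differentiable one_ne_zero 0).hasFDerivAt
    have hl : HasDerivAt (fun t : ℝ => t • θ) θ 0 := by
      simpa using (hasDerivAt_id (0 : ℝ)).smul_const θ
    exact hd.comp_hasDerivAt (0 : ℝ) hl
  have hi (w x : Space) : HasDerivAt (fun t : ℝ => inner ℝ w (rot3 u (t • θ) x))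
      (inner ℝ w (cross (∑ i, θ i • u i) x)) 0 := by
    simpa using (hasDerivAt_const (0 : ℝ) w).inner ℝ (hasDerivAt_rot3_line u θ x)
  refine h1.unique (hasDerivAt_pi.2 fun i => ?_)
  fin_cases i
  · exact hi _ _
  · exact hi _ _
  · exact hi _ _

/-- With `w = ∑ i, θ i • u i`, the three components of the derivative are, up to sign, the
coordinates of `w` in the orthonormal frame `v`, `n`, `cross v n`. If they vanish, so does `w`, and
independence of the axes gives `θ = 0`. -/
lemma fderiv_closingMap_injective {u : Fin 3 → Space} (hu : LinearIndependent ℝ u) {v n : Space}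
    (hv : ‖v‖ = 1) (hn : ‖n‖ = 1) (hvn : inner ℝ v n = 0) :
    Function.Injective (fderiv ℝ (closingMap u v n) 0) := by
  refine (injective_iff_map_eq_zero _).2 fun θ hθ => ?_
  rw [fderiv_closingMap] at hθ
  set w := ∑ i, θ i • u i with hw
  have e0 := congrFun hθ 0
  have e1 := congrFun hθ 1
  have e2 := congrFun hθ 2
  simp only [Matrix.cons_val_zero, Matrix.cons_val_one, Matrix.cons_val, Pi.zero_apply]
    at e0 e1 e2
  have i0 : inner ℝ (cross v n) (cross w n) =
      inner ℝ v w * inner ℝ n n - inner ℝ n w * inner ℝ v n := by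
    simp only [inner_eq_sum, cross_apply_zero, cross_apply_one, cross_apply_two]; ring
  have i1 : inner ℝ (cross v n) (cross w v) =
      inner ℝ v w * inner ℝ v n - inner ℝ n w * inner ℝ v v := by
    simp only [inner_eq_sum, cross_apply_zero, cross_apply_one, cross_apply_two]; ring
  have i2 : inner ℝ n (cross w v) = inner ℝ (cross v n) w := by
    simp only [inner_eq_sum, cross_apply_zero, cross_apply_one, cross_apply_two]; ring
  rw [i0, hvn, real_inner_self_eq_norm_sq, hn] at e0
  rw [i1, hvn, real_inner_self_eq_norm_sq, hv] at e1
  have h := norm_sq_eq_of_orthonormal hv hn hvn w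
  rw [← i2, e2] at h
  have hw0 : w = 0 := by
    have : ‖w‖ ^ 2 = 0 := by
      rw [h]
      have a : inner ℝ v w = (0 : ℝ) := by linarith
      have b : inner ℝ n w = (0 : ℝ) := by linarith
      rw [a, b]; norm_num
    simpa using this
  exact funext fun i => Fintype.linearIndependent_iff.1 hu θ hw0 i

/-- Three hinges in independent directions can be turned so that the composite is a rotation
about a given axis `v`, through a small angle of either sign. -/
lemma exists_closing {u : Fin 3 → Space} (hu : LinearIndependent ℝ u) (hu1 : ∀ i, ‖u i‖ = 1)
    {v n : Space} (hv : ‖v‖ = 1) (hn : ‖n‖ = 1) (hvn : inner ℝ v n = 0) :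
    ∃ a : ℝ → Fin 3 → ℝ, Continuous a ∧ a 0 = 0 ∧ ∀ s, rot3 u (a s) v = v ∧
      (0 < s → 0 < inner ℝ (cross v n) (rot3 u (a s) n)) ∧
      (s < 0 → inner ℝ (cross v n) (rot3 u (a s) n) < 0) := by
  let e : (Fin 3 → ℝ) ≃L[ℝ] (Fin 3 → ℝ) := (LinearEquiv.ofInjectiveEndo
    (fderiv ℝ (closingMap u v n) 0 : (Fin 3 → ℝ) →ₗ[ℝ] (Fin 3 → ℝ))
    (fderiv_closingMap_injective hu hv hn hvn)).toContinuousLinearEquiv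
  have he : (e : (Fin 3 → ℝ) →L[ℝ] (Fin 3 → ℝ)) = fderiv ℝ (closingMap u v n) 0 := by
    ext1 x; rfl
  have hd : HasStrictFDerivAt (closingMap u v n) (e : (Fin 3 → ℝ) →L[ℝ] (Fin 3 → ℝ)) 0 := by
    rw [he]
    exact (contDiff_closingMap u v n).contDiffAt.hasStrictFDerivAt one_ne_zero
  have hz : closingMap u v n 0 = 0 := by
    have h1 : inner ℝ (cross v n) n = 0 := by rw [real_inner_comm, inner_cross_self]
    have h2 : inner ℝ (cross v n) v = 0 := by rw [real_inner_comm, inner_self_cross]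
    have h3 : inner ℝ n v = 0 := by rw [real_inner_comm, hvn]
    funext i
    fin_cases i <;> simp [closingMap, h1, h2, h3]
  set φ := hd.toOpenPartialHomeomorph with hφ
  have hφc : (φ : (Fin 3 → ℝ) → Fin 3 → ℝ) = closingMap u v n := hd.toOpenPartialHomeomorph_coe
  have h0s : (0 : Fin 3 → ℝ) ∈ φ.source := hd.mem_toOpenPartialHomeomorph_source
  have h0t : (0 : Fin 3 → ℝ) ∈ φ.target := by
    have := hd.image_mem_toOpenPartialHomeomorph_target
    rwa [hz] at this
  have hs0 : φ.symm 0 = 0 := by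
    have := φ.left_inv h0s
    rwa [hφc, hz] at this
  have hcont : ContinuousAt φ.symm 0 := φ.continuousAt_symm h0t
  -- Near the identity the image of `v` cannot be `-v`.
  have hpos : ∀ᶠ y in nhds (0 : Fin 3 → ℝ), 0 < inner ℝ v (rot3 u (φ.symm y) v) := by
    have hc : ContinuousAt (fun y => inner ℝ v (rot3 u (φ.symm y) v)) 0 := by
      have : Continuous fun θ => inner ℝ v (rot3 u θ v) := by fun_prop
      exact this.continuousAt.comp hcont
    refine hc.eventually (lt_mem_nhds ?_)
    simp only [hs0, rot3_zero, real_inner_self_eq_norm_sq, hv]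
    norm_num
  have hsingle : Continuous fun s : ℝ => (![s, 0, 0] : Fin 3 → ℝ) := by
    refine continuous_pi fun i => ?_
    fin_cases i
    · exact continuous_id
    · exact continuous_const
    · exact continuous_const
  have hsingle0 : (![(0 : ℝ), 0, 0] : Fin 3 → ℝ) = 0 := by
    funext i; fin_cases i <;> rfl
  have hev : ∀ᶠ s in nhds (0 : ℝ), ![s, 0, 0] ∈ φ.target ∧
      0 < inner ℝ v (rot3 u (φ.symm ![s, 0, 0]) v) := by
    have ht : Filter.Tendsto (fun s : ℝ => (![s, 0, 0] : Fin 3 → ℝ)) (nhds 0) (nhds 0) := by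
      have := hsingle.tendsto 0
      rwa [hsingle0] at this
    have hm : ∀ᶠ y in nhds 0, y ∈ φ.target := φ.open_target.mem_nhds h0t
    exact ht.eventually (hm.and hpos)
  obtain ⟨δ, hδ, hball⟩ := Metric.eventually_nhds_iff.1 hev
  -- Clamping the parameter keeps it where the local inverse is defined and preserves its sign, so
  -- that the path `a` is continuous on all of `ℝ`.
  let k : ℝ → ℝ := fun s => max (-(δ / 2)) (min (δ / 2) s)
  have hk : Continuous k := by fun_prop
  have hkδ : ∀ s, dist (k s) 0 < δ := fun s => by
    rw [Real.dist_eq, sub_zero, abs_lt]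
    constructor
    · exact lt_of_lt_of_le (by linarith) (le_max_left _ _)
    · exact lt_of_le_of_lt (max_le (by linarith) (min_le_left _ _)) (by linarith : δ / 2 < δ)
  have hk0 : k 0 = 0 := by
    simp only [k]
    rw [min_eq_right (by linarith), max_eq_right (by linarith)]
  refine ⟨fun s => φ.symm ![k s, 0, 0], ?_, ?_, fun s => ?_⟩
  · exact φ.continuousOn_symm.comp_continuous (hsingle.comp hk) fun s => (hball (hkδ s)).1
  · simp only [hk0, hsingle0, hs0]
  · have hr := φ.right_inv (hball (hkδ s)).1
    rw [hφc] at hr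
    have e0 := congrFun hr 0
    have e1 := congrFun hr 1
    have e2 := congrFun hr 2
    simp only [closingMap, Matrix.cons_val_zero, Matrix.cons_val_one, Matrix.cons_val] at e0 e1 e2
    refine ⟨eq_of_inner_pos_of_orthogonal hv hn hvn (by rw [norm_rot3 hu1, hv])
      (hball (hkδ s)).2 e2 e1, fun hs => ?_, fun hs => ?_⟩
    · rw [e0]
      exact lt_max_of_lt_right (lt_min (by linarith) hs)
    · rw [e0]
      exact max_lt (by linarith) (min_lt_of_right_lt hs)

/-! ### Polar coordinates and crease lines. -/

/-- The point at distance `r` from the vertex in the direction that makes the angle `β` with `c`. -/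
noncomputable def polarPoint (c : Circle) (r β : ℝ) : ℂ := r * ((Circle.exp β * c : Circle) : ℂ)

lemma polarPoint_zero_angle (c : Circle) (r : ℝ) : polarPoint c r 0 = r * c := by
  simp [polarPoint]

lemma norm_polarPoint (c : Circle) {r : ℝ} (hr : 0 ≤ r) (β : ℝ) : ‖polarPoint c r β‖ = r := by
  rw [polarPoint, norm_mul, Circle.norm_coe, mul_one, Complex.norm_real, Real.norm_of_nonneg hr]

lemma polarPoint_eq_smul (c : Circle) (r β : ℝ) :
    polarPoint c r β = r • ((Circle.exp β * c : Circle) : ℂ) := by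
  simp [polarPoint]

lemma polarPoint_eq_cos_sin (c : Circle) (r β : ℝ) :
    polarPoint c r β = r • (Real.cos β • (c : ℂ) + Real.sin β • (Complex.I * c)) := by
  simp only [polarPoint, Circle.coe_mul, Circle.coe_exp, Complex.exp_mul_I, Complex.real_smul,
    Complex.ofReal_cos, Complex.ofReal_sin]
  ring

lemma polarPoint_add (c : Circle) (r β γ : ℝ) :
    polarPoint (Circle.exp β * c) r γ = polarPoint c r (β + γ) := by
  simp only [polarPoint, Circle.exp_add, mul_left_comm, mul_comm]

@[fun_prop]
lemma continuous_polarPoint (c : Circle) {X : Type*} [TopologicalSpace X] {r β : X → ℝ}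
    (hr : Continuous r) (hβ : Continuous β) : Continuous fun x => polarPoint c (r x) (β x) := by
  simp only [polarPoint_eq_cos_sin]
  fun_prop

lemma arg_polarPoint_div (c : Circle) {r β : ℝ} (hr : 0 < r) (h1 : -Real.pi < β)
    (h2 : β ≤ Real.pi) : Complex.arg (polarPoint c r β / c) = β := by
  have : polarPoint c r β / c = r * Complex.exp (β * Complex.I) := by
    rw [polarPoint, Circle.coe_mul, Circle.coe_exp]
    field_simp [Circle.coe_ne_zero]
  rw [this, Complex.arg_real_mul _ hr, Complex.exp_mul_I,
    Complex.arg_cos_add_sin_mul_I ⟨h1, h2⟩]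

lemma eq_polarPoint (c : Circle) (x : ℂ) :
    x = polarPoint c ‖x‖ (Complex.arg (x / c)) := by
  have h := Complex.norm_mul_exp_arg_mul_I (x / c)
  rw [norm_div, Circle.norm_coe, div_one] at h
  rw [polarPoint, Circle.coe_mul, Circle.coe_exp, ← mul_assoc, h, div_mul_cancel₀]
  exact Circle.coe_ne_zero c

lemma exists_eq_norm_mul (x : ℂ) : ∃ c : Circle, x = ‖x‖ * (c : ℂ) :=
  ⟨Circle.exp (Complex.arg x), by rw [Circle.coe_exp, Complex.norm_mul_exp_arg_mul_I]⟩

lemma exp_mul_ne_self (c : Circle) {β : ℝ} (h0 : β ≠ 0) (h : |β| < 2 * Real.pi) :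
    Circle.exp β * c ≠ c := by
  intro he
  rw [mul_eq_right, Circle.exp_eq_one] at he
  obtain ⟨n, hn⟩ := he
  rw [hn, abs_mul, abs_of_pos Real.two_pi_pos, mul_lt_iff_lt_one_left Real.two_pi_pos] at h
  have : n = 0 := Int.abs_lt_one_iff.1 (by exact_mod_cast h)
  simp [hn, this] at h0

lemma mem_creaseLines_iff {C : Set Circle} {r : ℝ} (hr : 0 < r) (c : Circle) :
    (r : ℂ) * c ∈ creaseLines C ↔ c ∈ C := by
  simp only [creaseLines, Set.mem_iUnion, ray, Set.mem_ofPred_eq, exists_prop]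
  constructor
  · rintro ⟨d, hd, s, hs, h⟩
    have hn := congrArg norm h
    simp only [norm_mul, Circle.norm_coe, mul_one, Complex.norm_real, Real.norm_of_nonneg hr.le,
      Real.norm_of_nonneg hs] at hn
    subst hn
    have : c = d := Circle.ext (mul_left_cancel₀ (by exact_mod_cast hr.ne') h)
    exact this ▸ hd
  · exact fun h => ⟨c, h, r, hr.le, rfl⟩

lemma polarPoint_mem_creaseLines_iff {C : Set Circle} {r : ℝ} (hr : 0 < r) (c : Circle) (β : ℝ) :
    polarPoint c r β ∈ creaseLines C ↔ Circle.exp β * c ∈ C :=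
  mem_creaseLines_iff hr _

lemma smul_mem_creaseLines_iff {C : Set Circle} {t : ℝ} (ht : 0 < t) (x : ℂ) :
    t • x ∈ creaseLines C ↔ x ∈ creaseLines C := by
  simp only [creaseLines, Set.mem_iUnion, ray, Set.mem_ofPred_eq, exists_prop, Complex.real_smul]
  have ht' : (t : ℂ) ≠ 0 := by exact_mod_cast ht.ne'
  constructor
  · rintro ⟨d, hd, s, hs, h⟩
    refine ⟨d, hd, s / t, by positivity, ?_⟩
    push_cast
    field_simp
    linear_combination h
  · rintro ⟨d, hd, s, hs, h⟩
    refine ⟨d, hd, t * s, by positivity, ?_⟩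
    rw [h]; push_cast; ring

lemma zero_mem_creaseLines {C : Set Circle} (hC : C.Nonempty) : (0 : ℂ) ∈ creaseLines C := by
  obtain ⟨c, hc⟩ := hC
  exact Set.mem_biUnion hc ⟨0, le_rfl, by simp⟩

/-- A direction has an angular neighbourhood that contains no crease but possibly itself. -/
lemma exists_crease_free {C : Set Circle} (hC : C.Finite) (c : Circle) :
    ∃ δ, 0 < δ ∧ δ < Real.pi ∧ ∀ β, β ≠ 0 → |β| < δ → Circle.exp β * c ∉ C := by
  have h1 : ∀ᶠ d in nhds c, d ∉ C \ {c} :=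
    (hC.subset Set.sdiff_subset).isClosed.isOpen_compl.mem_nhds (by simp)
  have h2 : Filter.Tendsto (fun β : ℝ => Circle.exp β * c) (nhds 0) (nhds c) := by
    have : Continuous fun β : ℝ => Circle.exp β * c := by fun_prop
    simpa using this.tendsto 0
  obtain ⟨ε, hε, h⟩ := Metric.eventually_nhds_iff.1 (h2.eventually h1)
  refine ⟨min ε (Real.pi / 2), by positivity, ?_, fun β h0 hβ hm => ?_⟩
  · exact (min_le_right _ _).trans_lt (by linarith [Real.pi_pos])
  · refine h (y := β) ?_ ⟨hm, exp_mul_ne_self c h0 ?_⟩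
    · rw [Real.dist_eq, sub_zero]; exact hβ.trans_le (min_le_left _ _)
    · have := hβ.trans_le (min_le_right _ _)
      linarith [Real.pi_pos]

/-! ### Radial structure of a rigid folding and the cone over a small circle. -/

lemma IsRigidFolding.dist_eq_of_isPreconnected {A : Set ℂ} {C : Set Circle} {f : ℂ → Space}
    (hf : IsRigidFolding A C f) {T : Set ℂ} (hT : IsPreconnected T)
    (hTA : T ⊆ A \ creaseLines C) {x y : ℂ} (hx : x ∈ T) (hy : y ∈ T) :
    dist (f x) (f y) = dist x y :=
  hf.isometry_face _ ⟨x, hTA hx, rfl⟩ x (mem_connectedComponentIn (hTA hx)) y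
    (hT.subset_connectedComponentIn hx hTA hy)

lemma IsRigidFolding.dist_smul {A : Set ℂ} {C : Set Circle} {f : ℂ → Space}
    (hf : IsRigidFolding A C f) {x : ℂ} (hxA : ∀ t ∈ Set.Icc (0 : ℝ) 1, t • x ∈ A)
    (hx : x ∉ creaseLines C) {s t : ℝ} (hs : s ∈ Set.Icc (0 : ℝ) 1)
    (ht : t ∈ Set.Icc (0 : ℝ) 1) : dist (f (s • x)) (f (t • x)) = |s - t| * ‖x‖ := by
  have hcont : ContinuousOn (fun r : ℝ => f (r • x)) (Set.Icc 0 1) :=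
    hf.continuousOn.comp (by fun_prop) hxA
  have hT : IsPreconnected ((fun r : ℝ => r • x) '' Set.Ioc 0 1) :=
    isPreconnected_Ioc.image _ (by fun_prop)
  have hTA : ((fun r : ℝ => r • x) '' Set.Ioc 0 1) ⊆ A \ creaseLines C := by
    rintro _ ⟨r, hr, rfl⟩
    exact ⟨hxA r ⟨hr.1.le, hr.2⟩, fun h => hx ((smul_mem_creaseLines_iff hr.1 x).1 h)⟩
  have hcl : closure (Set.Ioc (0 : ℝ) 1) = Set.Icc 0 1 := closure_Ioc zero_ne_one
  have key : ∀ p ∈ Set.Icc (0 : ℝ) 1 ×ˢ Set.Icc (0 : ℝ) 1,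
      dist (f (p.1 • x)) (f (p.2 • x)) = |p.1 - p.2| * ‖x‖ := by
    -- The vertex itself lies in no face once there is a crease, so the isometry is used for
    -- parameters in the half-open interval and extended to zero by continuity.
    have h1 : Set.EqOn (fun p : ℝ × ℝ => dist (f (p.1 • x)) (f (p.2 • x)))
        (fun p => |p.1 - p.2| * ‖x‖) (Set.Ioc (0 : ℝ) 1 ×ˢ Set.Ioc (0 : ℝ) 1) := by
      intro p hp
      have := hf.dist_eq_of_isPreconnected hT hTA ⟨p.1, hp.1, rfl⟩ ⟨p.2, hp.2, rfl⟩
      simp only at this ⊢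
      rw [this, dist_eq_norm, ← sub_smul, norm_smul, Real.norm_eq_abs]
    refine h1.of_subset_closure ?_ (by fun_prop) ?_ ?_
      (t := Set.Icc (0 : ℝ) 1 ×ˢ Set.Icc (0 : ℝ) 1)
    · have hfst : ContinuousOn (fun p : ℝ × ℝ => f (p.1 • x))
          (Set.Icc (0 : ℝ) 1 ×ˢ Set.Icc (0 : ℝ) 1) :=
        hcont.comp continuousOn_fst fun p hp => hp.1
      have hsnd : ContinuousOn (fun p : ℝ × ℝ => f (p.2 • x))
          (Set.Icc (0 : ℝ) 1 ×ˢ Set.Icc (0 : ℝ) 1) :=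
        hcont.comp continuousOn_snd fun p hp => hp.2
      exact continuous_dist.comp_continuousOn (hfst.prodMk hsnd)
    · exact Set.prod_mono Set.Ioc_subset_Icc_self Set.Ioc_subset_Icc_self
    · rw [closure_prod_eq, hcl]
  exact key (s, t) ⟨hs, ht⟩

/-- Equality in the triangle inequality forces `p` onto the segment, by strict convexity of the
Euclidean norm. -/
lemma eq_smul_of_dist {a b p : Space} {t : ℝ}
    (h1 : dist a p = t * dist a b) (h2 : dist p b = (1 - t) * dist a b) :
    p - a = t • (b - a) := by
  by_cases hab : a = b
  · subst hab
    have : a = p := by simpa using h1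
    simp [this]
  have hw : Wbtw ℝ a p b := dist_add_dist_eq_iff.1 (by rw [h1, h2]; ring)
  obtain ⟨r, hr, rfl⟩ := hw
  rw [dist_left_lineMap, Real.norm_of_nonneg hr.1] at h1
  rw [mul_right_cancel₀ (dist_ne_zero.2 hab) h1, AffineMap.lineMap_apply]
  simp

/-- Off the creases, a radius is mapped isometrically, hence onto a straight segment. Points on a
crease are limits of points off the creases, and both claims survive the limit. -/
lemma IsRigidFolding.radial {A : Set ℂ} {C : Set Circle} {f : ℂ → Space}
    (hf : IsRigidFolding A C f) (hC : C.Finite) {ρ : ℝ}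
    (hA : Metric.closedBall 0 ρ ⊆ A) {x : ℂ} (hx : ‖x‖ ≤ ρ) :
    ‖f x - f 0‖ = ‖x‖ ∧ ∀ t ∈ Set.Icc (0 : ℝ) 1, f (t • x) - f 0 = t • (f x - f 0) := by
  have hmem : ∀ y : ℂ, ‖y‖ ≤ ρ → ∀ t ∈ Set.Icc (0 : ℝ) 1, t • y ∈ Metric.closedBall (0 : ℂ) ρ := by
    intro y hy t ht
    rw [mem_closedBall_zero_iff, norm_smul, Real.norm_of_nonneg ht.1]
    exact (mul_le_of_le_one_left (norm_nonneg _) ht.2).trans hy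
  have off : ∀ y : ℂ, ‖y‖ ≤ ρ → y ∉ creaseLines C →
      ‖f y - f 0‖ = ‖y‖ ∧ ∀ t ∈ Set.Icc (0 : ℝ) 1, f (t • y) - f 0 = t • (f y - f 0) := by
    intro y hy hyC
    have hd := fun {s t : ℝ} => hf.dist_smul (s := s) (t := t)
      (fun t ht => hA (hmem y hy t ht)) hyC
    have h01 : dist (f 0) (f y) = ‖y‖ := by
      simpa using hd (s := 0) (t := 1) (by simp) (by simp)
    refine ⟨by rw [← dist_eq_norm, dist_comm, h01], fun t ht => eq_smul_of_dist ?_ ?_⟩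
    · rw [h01]
      simpa [abs_of_nonneg ht.1] using hd (s := 0) (t := t) (by simp) ht
    · rw [h01]
      simpa [abs_sub_comm t 1, abs_of_nonneg (sub_nonneg.2 ht.2)] using
        hd (s := t) (t := 1) ht (by simp)
  rcases eq_or_ne x 0 with rfl | hx0
  · simp
  obtain ⟨c, hc⟩ := exists_eq_norm_mul x
  obtain ⟨δ, hδ, -, hfree⟩ := exists_crease_free hC c
  have hr : 0 < ‖x‖ := norm_pos_iff.2 hx0
  have hx' : polarPoint c ‖x‖ 0 = x := by rw [polarPoint_zero_angle, ← hc]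
  have hnorm : ∀ β, ‖polarPoint c ‖x‖ β‖ = ‖x‖ := norm_polarPoint c hr.le
  have hev : ∀ᶠ β in nhdsWithin (0 : ℝ) (Set.Ioi 0), polarPoint c ‖x‖ β ∉ creaseLines C := by
    filter_upwards [Ioo_mem_nhdsGT hδ] with β hβ
    rw [polarPoint_mem_creaseLines_iff hr]
    exact hfree β hβ.1.ne' (by rw [abs_of_pos hβ.1]; exact hβ.2)
  have hlim : ∀ t ∈ Set.Icc (0 : ℝ) 1, Filter.Tendsto (fun β => f (t • polarPoint c ‖x‖ β))
      (nhdsWithin (0 : ℝ) (Set.Ioi 0)) (nhds (f (t • x))) := by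
    intro t ht
    have hcont : Continuous fun β => f (t • polarPoint c ‖x‖ β) :=
      (hf.continuousOn.mono hA).comp_continuous (by fun_prop)
        fun β => hmem _ ((hnorm β).trans_le hx) t ht
    have := hcont.tendsto 0
    rw [hx'] at this
    exact this.mono_left nhdsWithin_le_nhds
  have hlim1 : Filter.Tendsto (fun β => f (polarPoint c ‖x‖ β))
      (nhdsWithin (0 : ℝ) (Set.Ioi 0)) (nhds (f x)) := by
    simpa using hlim 1 (by simp)
  constructor
  · refine tendsto_nhds_unique ((hlim1.sub_const (f 0)).norm) ?_
    refine tendsto_const_nhds.congr' ?_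
    filter_upwards [hev] with β hβ
    rw [(off _ ((hnorm β).trans_le hx) hβ).1, hnorm]
  · intro t ht
    refine tendsto_nhds_unique ((hlim t ht).sub_const (f 0)) ?_
    refine ((hlim1.sub_const (f 0)).const_smul t).congr' ?_
    filter_upwards [hev] with β hβ
    exact ((off _ ((hnorm β).trans_le hx) hβ).2 t ht).symm

/-- The cone over the restriction of `f` to the circle of radius `ρ`, with the image of the vertex
moved to the origin. -/
noncomputable def cone (ρ : ℝ) (f : ℂ → Space) (x : ℂ) : Space :=
  (‖x‖ / ρ) • (f ((ρ / ‖x‖) • x) - f 0)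

@[simp] lemma cone_zero (ρ : ℝ) (f : ℂ → Space) : cone ρ f 0 = 0 := by simp [cone]

lemma cone_smul (ρ : ℝ) (f : ℂ → Space) {t : ℝ} (ht : 0 ≤ t) (x : ℂ) :
    cone ρ f (t • x) = t • cone ρ f x := by
  rcases ht.eq_or_lt with rfl | ht
  · simp
  have : (ρ / (t * ‖x‖)) • t • x = (ρ / ‖x‖) • x := by
    rw [smul_smul]; congr 1; field_simp
  rw [cone, cone, norm_smul, Real.norm_of_nonneg ht.le, this, smul_smul, mul_div_assoc]

/-- A rigid folding of the plane that is positively homogeneous and preserves the distance from the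
vertex. -/
structure IsConeFolding (C : Set Circle) (f : ℂ → Space) : Prop
    extends IsRigidFolding Set.univ C f where
  map_smul : ∀ t : ℝ, 0 ≤ t → ∀ x, f (t • x) = t • f x
  norm_map : ∀ x, ‖f x‖ = ‖x‖

section Cone

variable {A : Set ℂ} {C : Set Circle} {f : ℂ → Space} {ρ : ℝ}

lemma norm_div_norm_smul_le (hρ : 0 < ρ) (x : ℂ) : ‖(ρ / ‖x‖) • x‖ ≤ ρ := by
  rcases eq_or_ne x 0 with rfl | hx
  · simpa using hρ.le
  · rw [norm_smul, norm_div, norm_norm, div_mul_cancel₀ _ (norm_ne_zero_iff.2 hx),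
      Real.norm_of_nonneg hρ.le]

lemma norm_cone (hf : IsRigidFolding A C f) (hC : C.Finite) (hρ : 0 < ρ)
    (hA : Metric.closedBall 0 ρ ⊆ A) (x : ℂ) : ‖cone ρ f x‖ = ‖x‖ := by
  rcases eq_or_ne x 0 with rfl | hx
  · simp
  rw [cone, norm_smul, (hf.radial hC hA (norm_div_norm_smul_le hρ x)).1, norm_smul, norm_div,
    norm_div, norm_norm]
  have := norm_ne_zero_iff.2 hx
  have := norm_ne_zero_iff.2 hρ.ne'
  field_simp

lemma cone_eq (hf : IsRigidFolding A C f) (hC : C.Finite) (hρ : 0 < ρ)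
    (hA : Metric.closedBall 0 ρ ⊆ A) {x : ℂ} (hx : ‖x‖ ≤ ρ) : cone ρ f x = f x - f 0 := by
  rcases eq_or_ne x 0 with rfl | hx0
  · simp
  have hn := norm_pos_iff.2 hx0
  have := (hf.radial hC hA (norm_div_norm_smul_le hρ x)).2 (‖x‖ / ρ)
    ⟨by positivity, (div_le_one hρ).2 hx⟩
  rw [cone, ← this, smul_smul, div_mul_div_cancel₀ hρ.ne', div_self hn.ne', one_smul]

lemma continuousOn_cone {T : Set ℝ} {F : ℝ → ℂ → Space}
    (hF : ContinuousOn (fun p : ℝ × ℂ => F p.1 p.2) (T ×ˢ A))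
    (hT : ∀ t ∈ T, IsRigidFolding A C (F t)) (hC : C.Finite) (hρ : 0 < ρ)
    (hA : Metric.closedBall 0 ρ ⊆ A) :
    ContinuousOn (fun p : ℝ × ℂ => cone ρ (F p.1) p.2) (T ×ˢ Set.univ) := by
  rintro ⟨t, x⟩ ⟨ht, -⟩
  rcases eq_or_ne x 0 with rfl | hx
  · rw [ContinuousWithinAt, cone_zero]
    refine squeeze_zero_norm' (a := fun p : ℝ × ℂ => ‖p.2‖) ?_ ?_
    · filter_upwards [self_mem_nhdsWithin] with p hp
      rw [norm_cone (hT p.1 hp.1) hC hρ hA]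
    · have : Continuous fun p : ℝ × ℂ => ‖p.2‖ := by fun_prop
      simpa using (this.tendsto (t, (0 : ℂ))).mono_left nhdsWithin_le_nhds
  · have hn : ‖x‖ ≠ 0 := norm_ne_zero_iff.2 hx
    have h0 : (0 : ℂ) ∈ A := hA (by simpa using hρ.le)
    have hm : ∀ y : ℂ, (ρ / ‖y‖) • y ∈ A := fun y =>
      hA (mem_closedBall_zero_iff.2 (norm_div_norm_smul_le hρ y))
    have h1 : ContinuousWithinAt (fun p : ℝ × ℂ => F p.1 ((ρ / ‖p.2‖) • p.2))
        (T ×ˢ Set.univ) (t, x) := by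
      have hg : ContinuousWithinAt (fun p : ℝ × ℂ => (p.1, (ρ / ‖p.2‖) • p.2))
          (T ×ˢ Set.univ) (t, x) := by
        have : ContinuousAt (fun p : ℝ × ℂ => (p.1, (ρ / ‖p.2‖) • p.2)) (t, x) := by
          fun_prop (disch := simpa using hn)
        exact this.continuousWithinAt
      have hFt : ContinuousWithinAt (fun p : ℝ × ℂ => F p.1 p.2) (T ×ˢ A)
          ((fun p : ℝ × ℂ => (p.1, (ρ / ‖p.2‖) • p.2)) (t, x)) := hF _ ⟨ht, hm x⟩
      exact hFt.comp (f := fun p : ℝ × ℂ => (p.1, (ρ / ‖p.2‖) • p.2)) hg fun p hp => ⟨hp.1, hm p.2⟩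
    have h2 : ContinuousWithinAt (fun p : ℝ × ℂ => F p.1 0) (T ×ˢ Set.univ) (t, x) := by
      have hg : Continuous fun p : ℝ × ℂ => (p.1, (0 : ℂ)) := by fun_prop
      have hFt : ContinuousWithinAt (fun p : ℝ × ℂ => F p.1 p.2) (T ×ˢ A)
          ((fun p : ℝ × ℂ => (p.1, (0 : ℂ))) (t, x)) := hF _ ⟨ht, h0⟩
      exact hFt.comp (f := fun p : ℝ × ℂ => (p.1, (0 : ℂ))) hg.continuousWithinAt
        fun p hp => ⟨hp.1, h0⟩
    have h3 : ContinuousWithinAt (fun p : ℝ × ℂ => ‖p.2‖ / ρ) (T ×ˢ Set.univ) (t, x) := by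
      have : Continuous fun p : ℝ × ℂ => ‖p.2‖ / ρ := by fun_prop
      exact this.continuousWithinAt
    exact h3.smul (h1.sub h2)

lemma IsRigidFolding.cone (hf : IsRigidFolding A C f) (hC : C.Finite)
    (hρ : 0 < ρ) (hA : Metric.closedBall 0 ρ ⊆ A) : IsConeFolding C (cone ρ f) where
  continuousOn := by
    have h := continuousOn_cone (T := Set.univ) (F := fun _ => f)
      (hf.continuousOn.comp continuousOn_snd fun p hp => hp.2) (fun _ _ => hf) hC hρ hA
    exact h.comp (f := fun x : ℂ => ((0 : ℝ), x)) (by fun_prop) fun x _ => ⟨trivial, trivial⟩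
  injOn := by
    intro x _ y _ h
    have hxy : ‖x‖ = ‖y‖ := by rw [← norm_cone hf hC hρ hA, h, norm_cone hf hC hρ hA]
    rcases eq_or_ne x 0 with rfl | hx
    · rw [norm_zero] at hxy; exact (norm_eq_zero.1 hxy.symm).symm
    have hn := norm_pos_iff.2 hx
    have hm : ∀ y : ℂ, (ρ / ‖y‖) • y ∈ A := fun y =>
      hA (mem_closedBall_zero_iff.2 (norm_div_norm_smul_le hρ y))
    have h1 : f ((ρ / ‖x‖) • x) = f ((ρ / ‖y‖) • y) := by
      rw [Origami.cone, Origami.cone, ← hxy] at h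
      have := smul_right_injective Space (by positivity : ‖x‖ / ρ ≠ 0) h
      rw [← hxy]
      exact sub_left_injective this
    have h2 := hf.injOn (hm x) (hm y) h1
    rw [← hxy] at h2
    exact smul_right_injective ℂ (by positivity : ρ / ‖x‖ ≠ 0) h2
  isometry_face := by
    rintro S ⟨z, hz, rfl⟩ x hx y hy
    set S := connectedComponentIn (Set.univ \ creaseLines C) z with hS
    have hSC : S ⊆ Set.univ \ creaseLines C := connectedComponentIn_subset _ _
    -- Shrinks the unbounded face into the ball of radius `ρ` on which `f` is controlled; the image
    -- stays connected and off the creases.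
    let q : ℂ × ℝ → ℂ := fun p => (p.2 * ρ / (1 + ‖p.1‖)) • p.1
    have hq : Continuous q := by
      have : ∀ p : ℂ × ℝ, 1 + ‖p.1‖ ≠ 0 := fun p => by positivity
      fun_prop (disch := exact this _)
    have hT : IsPreconnected (q '' (S ×ˢ Set.Ioc 0 1)) :=
      (isPreconnected_connectedComponentIn.prod isPreconnected_Ioc).image _ hq.continuousOn
    have hball : ∀ w ∈ q '' (S ×ˢ Set.Ioc 0 1), ‖w‖ ≤ ρ := by
      rintro _ ⟨⟨w, s⟩, ⟨hw, hs⟩, rfl⟩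
      have hs0 : 0 < s := hs.1
      have : 0 ≤ s * ρ / (1 + ‖w‖) := by positivity
      simp only [q, norm_smul, Real.norm_of_nonneg this]
      rw [div_mul_eq_mul_div, div_le_iff₀ (by positivity)]
      have : s * ρ ≤ ρ := mul_le_of_le_one_left hρ.le hs.2
      nlinarith [norm_nonneg w]
    have hTA : q '' (S ×ˢ Set.Ioc 0 1) ⊆ A \ creaseLines C := by
      intro w hw
      refine ⟨hA (mem_closedBall_zero_iff.2 (hball w hw)), ?_⟩
      obtain ⟨⟨w, s⟩, ⟨hw, hs⟩, rfl⟩ := hw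
      have hs0 : 0 < s := hs.1
      rw [smul_mem_creaseLines_iff (by positivity)]
      exact (hSC hw).2
    -- A common factor for both points, so that their distance is scaled by `t` as a whole.
    let t := ρ / (1 + ‖x‖ + ‖y‖)
    have ht : 0 < t := by positivity
    have hmem : ∀ w ∈ S, ‖w‖ ≤ ‖x‖ + ‖y‖ → t • w ∈ q '' (S ×ˢ Set.Ioc 0 1) := by
      intro w hw hwn
      refine ⟨(w, t * (1 + ‖w‖) / ρ), ⟨hw, by positivity, ?_⟩, ?_⟩
      · simp only [t]
        rw [div_mul_eq_mul_div, div_div, div_le_one (by positivity)]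
        nlinarith
      · simp only [q]
        congr 1
        have : 1 + ‖w‖ ≠ 0 := by positivity
        field_simp
    have hxT := hmem x hx (by linarith [norm_nonneg y])
    have hyT := hmem y hy (by linarith [norm_nonneg x])
    have hd := hf.dist_eq_of_isPreconnected hT hTA hxT hyT
    have h1 := cone_eq hf hC hρ hA (hball _ hxT)
    have h2 := cone_eq hf hC hρ hA (hball _ hyT)
    rw [← dist_sub_right _ _ (f 0), ← h1, ← h2, cone_smul _ _ ht.le, cone_smul _ _ ht.le,
      dist_smul₀, dist_smul₀] at hd
    exact mul_left_cancel₀ (norm_ne_zero_iff.2 ht.ne') hd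
  map_smul := fun _ ht x => cone_smul ρ f ht x
  norm_map := norm_cone hf hC hρ hA

lemma HasFoldingAngle.cone {c : Circle} {θ : ℝ} (h : HasFoldingAngle A f c θ)
    (hf : IsRigidFolding A C f) (hC : C.Finite) (hρ : 0 < ρ) (hA : Metric.closedBall 0 ρ ⊆ A) :
    HasFoldingAngle Set.univ (cone ρ f) c θ := by
  obtain ⟨L, R, ⟨ε, hε, h⟩, hθ⟩ := h
  refine ⟨L, R, ⟨ε, hε, fun x _ => ?_⟩, hθ⟩
  rcases eq_or_ne x 0 with rfl | hx
  · simp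
  have hn := norm_pos_iff.2 hx
  let t := ρ / ‖x‖
  have ht : 0 < t := by positivity
  have htn : ‖t • x‖ ≤ ρ := norm_div_norm_smul_le hρ x
  have harg : Complex.arg (t • x / (c : ℂ)) = Complex.arg (x / c) := by
    rw [Complex.real_smul, mul_div_assoc, Complex.arg_real_mul _ ht]
  have h' := h (t • x) (hA (mem_closedBall_zero_iff.2 htn))
  rw [harg] at h'
  have hlift : ∀ M : ℂ →ₗᵢ[ℝ] Space, f (t • x) = f 0 + M (t • x) →
      Origami.cone ρ f x = Origami.cone ρ f 0 + M x := by
    intro M hM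
    have h1 := cone_eq hf hC hρ hA htn
    rw [hM, cone_smul _ _ ht.le, add_sub_cancel_left, map_smul] at h1
    rw [cone_zero, zero_add]
    exact smul_right_injective Space ht.ne' h1
  exact ⟨fun a b => hlift L (h'.1 a b), fun a b => hlift R (h'.2 a b)⟩

lemma IsRigidFolding.restrict {g : ℂ → Space} (hg : IsRigidFolding Set.univ C g) (A : Set ℂ) :
    IsRigidFolding A C g where
  continuousOn := hg.continuousOn.mono (Set.subset_univ _)
  injOn := hg.injOn.mono (Set.subset_univ _)
  isometry_face := by
    rintro S ⟨z, hz, rfl⟩ x hx y hy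
    have hsub := connectedComponentIn_subset (A \ creaseLines C) z
    exact hg.dist_eq_of_isPreconnected isPreconnected_connectedComponentIn
      (hsub.trans (Set.sdiff_subset_sdiff_left (Set.subset_univ _))) hx hy

lemma HasFoldingAngle.restrict {g : ℂ → Space} {c : Circle} {θ : ℝ}
    (h : HasFoldingAngle Set.univ g c θ) (A : Set ℂ) : HasFoldingAngle A g c θ := by
  obtain ⟨L, R, ⟨ε, hε, h⟩, hθ⟩ := h
  exact ⟨L, R, ⟨ε, hε, fun x _ => h x trivial⟩, hθ⟩

end Cone

/-! ### Linear parts on sectors and folding angles. -/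

lemma inner_circle_self (c : Circle) : inner ℝ (c : ℂ) (c : ℂ) = 1 := by
  rw [real_inner_self_eq_norm_sq, Circle.norm_coe, one_pow]

lemma inner_I_mul_circle_self (c : Circle) :
    inner ℝ (Complex.I * c) (Complex.I * (c : ℂ)) = 1 := by
  rw [real_inner_self_eq_norm_sq, norm_mul, Complex.norm_I, Circle.norm_coe]; norm_num

lemma inner_circle_I_mul (c : Circle) : inner ℝ (c : ℂ) (Complex.I * c) = 0 := by
  rw [Complex.inner]; simp; ring

lemma inner_polarPoint (c : Circle) (r s α β : ℝ) :
    inner ℝ (polarPoint c r α) (polarPoint c s β) = r * s * Real.cos (β - α) := by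
  simp only [polarPoint_eq_cos_sin, inner_smul_left, inner_smul_right, inner_add_left,
    inner_add_right, inner_circle_self, inner_I_mul_circle_self, inner_circle_I_mul,
    real_inner_comm (c : ℂ) (Complex.I * c), Real.cos_sub, RCLike.conj_to_real]
  ring

lemma map_polarPoint (L : ℂ →ₗᵢ[ℝ] Space) (c : Circle) (r β : ℝ) :
    L (polarPoint c r β) = r • (Real.cos β • L c + Real.sin β • L (Complex.I * c)) := by
  rw [polarPoint_eq_cos_sin, map_smul, map_add, map_smul, map_smul]

lemma exists_linearIsometry (c : Circle) {u w : Space} (hu : ‖u‖ = 1) (hw : ‖w‖ = 1)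
    (huw : inner ℝ u w = 0) :
    ∃ L : ℂ →ₗᵢ[ℝ] Space, L c = u ∧ L (Complex.I * c) = w := by
  let l : ℂ →ₗ[ℝ] Space := Complex.reLm.smulRight u + Complex.imLm.smulRight w
  have hl : ∀ z, l z = z.re • u + z.im • w := fun z => rfl
  have hn : ∀ z, ‖l z‖ = ‖z‖ := by
    intro z
    rw [← sq_eq_sq₀ (norm_nonneg _) (norm_nonneg _), hl, @norm_add_sq_real, norm_smul, norm_smul,
      inner_smul_left, inner_smul_right, huw, hu, hw, Complex.sq_norm, Complex.normSq_apply]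
    simp only [mul_one, Real.norm_eq_abs, sq_abs, mul_zero, add_zero]
    ring
  refine ⟨LinearIsometry.comp ⟨l, hn⟩ (rotation c⁻¹).toLinearIsometry, ?_, ?_⟩
  · change l ((c⁻¹ : Circle) * (c : ℂ)) = u
    rw [Circle.coe_inv, inv_mul_cancel₀ (Circle.coe_ne_zero c), hl]
    simp
  · change l ((c⁻¹ : Circle) * (Complex.I * (c : ℂ))) = w
    rw [Circle.coe_inv, mul_left_comm, inv_mul_cancel₀ (Circle.coe_ne_zero c), hl]
    simp

/-- Agreement at two directions determines a linear map. -/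
lemma linearIsometry_eq_of_two {L M : ℂ →ₗᵢ[ℝ] Space} {c : Circle} {α β : ℝ}
    (hαβ : Real.sin (β - α) ≠ 0) (h1 : L (polarPoint c 1 α) = M (polarPoint c 1 α))
    (h2 : L (polarPoint c 1 β) = M (polarPoint c 1 β)) :
    L c = M c ∧ L (Complex.I * c) = M (Complex.I * c) := by
  simp only [map_polarPoint, one_smul] at h1 h2
  rw [Real.sin_sub] at hαβ
  constructor
  · refine smul_right_injective Space hαβ ?_
    simp only
    linear_combination (norm := module) Real.sin β • h1 - Real.sin α • h2
  · refine smul_right_injective Space hαβ ?_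
    simp only
    linear_combination (norm := module) Real.cos α • h2 - Real.cos β • h1

section Sector

variable {C : Set Circle} {f : ℂ → Space}

lemma IsConeFolding.map_zero (hf : IsConeFolding C f) : f 0 = 0 := by
  simpa using hf.norm_map 0

lemma IsConeFolding.continuous (hf : IsConeFolding C f) : Continuous f :=
  continuousOn_univ.1 hf.continuousOn

/-- A folding is linear on a closed sector without creases in the interior. -/
lemma IsConeFolding.exists_eq_on_sector (hf : IsConeFolding C f) (b : Circle) {p q : ℝ}
    (hpq : p < q) (hfree : ∀ β ∈ Set.Ioo p q, Circle.exp β * b ∉ C) :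
    ∃ L : ℂ →ₗᵢ[ℝ] Space, ∀ r : ℝ, 0 ≤ r → ∀ β ∈ Set.Icc p q,
      f (polarPoint b r β) = L (polarPoint b r β) := by
  have hS : IsPreconnected ((fun y : ℝ × ℝ => polarPoint b y.1 y.2) '' (Set.Ioi 0 ×ˢ Set.Ioo p q)) :=
    (isPreconnected_Ioi.prod isPreconnected_Ioo).image _ (by fun_prop)
  have hSC : (fun y : ℝ × ℝ => polarPoint b y.1 y.2) '' (Set.Ioi 0 ×ˢ Set.Ioo p q) ⊆
      Set.univ \ creaseLines C := by
    rintro _ ⟨y, ⟨hr, hβ⟩, rfl⟩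
    refine ⟨trivial, ?_⟩
    rw [polarPoint_mem_creaseLines_iff hr]
    exact hfree _ hβ
  have hinner : ∀ r s α β, 0 < r → 0 < s → α ∈ Set.Ioo p q → β ∈ Set.Ioo p q →
      inner ℝ (f (polarPoint b r α)) (f (polarPoint b s β)) = r * s * Real.cos (β - α) := by
    intro r s α β hr hs hα hβ
    have hd := hf.dist_eq_of_isPreconnected hS hSC ⟨(r, α), ⟨hr, hα⟩, rfl⟩ ⟨(s, β), ⟨hs, hβ⟩, rfl⟩
    rw [← inner_polarPoint b,
      real_inner_eq_norm_mul_self_add_norm_mul_self_sub_norm_sub_mul_self_div_two,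
      real_inner_eq_norm_mul_self_add_norm_mul_self_sub_norm_sub_mul_self_div_two,
      hf.norm_map, hf.norm_map, ← dist_eq_norm, ← dist_eq_norm, hd]
  let m := (p + q) / 2
  let γ := min ((q - p) / 4) (Real.pi / 2)
  have hγ0 : 0 < γ := lt_min (by linarith) (by positivity)
  have hγq : γ ≤ (q - p) / 4 := min_le_left _ _
  have hγπ : γ < Real.pi := (min_le_right _ _).trans_lt (by linarith [Real.pi_pos])
  have hsin : Real.sin γ ≠ 0 := (Real.sin_pos_of_pos_of_lt_pi hγ0 hγπ).ne'
  have hm : m ∈ Set.Ioo p q := ⟨by simp only [m]; linarith, by simp only [m]; linarith⟩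
  have hmγ : m + γ ∈ Set.Ioo p q := ⟨by simp only [m]; linarith, by simp only [m]; linarith⟩
  -- The images of two independent directions in the sector yield an orthonormal pair `u`, `w` and
  -- thereby the candidate `L`. Inner products with this pair then determine `f` in the open sector,
  -- and continuity gives the closed one.
  set u := f (polarPoint b 1 m) with hu
  set e := f (polarPoint b 1 (m + γ)) with he
  have huu : inner ℝ u u = 1 := by simpa using hinner 1 1 m m one_pos one_pos hm hm
  have hee : inner ℝ e e = 1 := by simpa using hinner 1 1 _ _ one_pos one_pos hmγ hmγ
  have hue : inner ℝ u e = Real.cos γ := by simpa using hinner 1 1 _ _ one_pos one_pos hm hmγ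
  set w := (Real.sin γ)⁻¹ • (e - Real.cos γ • u) with hw
  have huw : inner ℝ u w = 0 := by
    rw [hw, inner_smul_right, inner_sub_right, inner_smul_right, huu, hue]; simp
  have hww : inner ℝ w w = 1 := by
    rw [hw, inner_smul_right, inner_smul_left, inner_sub_right, inner_sub_left, inner_sub_left,
      inner_smul_right, inner_smul_left, inner_smul_right, inner_smul_left, huu, hue, hee,
      real_inner_comm u e, hue]
    simp only [RCLike.conj_to_real]
    field_simp
    linear_combination -Real.sin_sq_add_cos_sq γ
  have hnu : ‖u‖ = 1 := by rw [norm_eq_sqrt_real_inner, huu, Real.sqrt_one]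
  have hnw : ‖w‖ = 1 := by rw [norm_eq_sqrt_real_inner, hww, Real.sqrt_one]
  obtain ⟨L, hL1, hL2⟩ := exists_linearIsometry (Circle.exp m * b) hnu hnw huw
  refine ⟨L, fun r hr β hβ => ?_⟩
  rcases hr.eq_or_lt with rfl | hr
  · simp [polarPoint, hf.map_zero]
  have hopen : Set.EqOn (fun β => f (polarPoint b r β)) (fun β => L (polarPoint b r β))
      (Set.Ioo p q) := by
    intro β hβ
    have h1 : inner ℝ (f (polarPoint b r β)) u = r * Real.cos (β - m) := by
      rw [hinner r 1 β m hr one_pos hβ hm, mul_one, ← Real.cos_neg, neg_sub]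
    have h2 : inner ℝ (f (polarPoint b r β)) e = r * Real.cos (β - m - γ) := by
      rw [hinner r 1 β _ hr one_pos hβ hmγ, mul_one, ← Real.cos_neg]; congr 2; ring
    have h3 : inner ℝ (f (polarPoint b r β)) w = r * Real.sin (β - m) := by
      rw [hw, inner_smul_right, inner_sub_right, inner_smul_right, h1, h2, Real.cos_sub (β - m) γ]
      field_simp
      ring
    have hLβ : L (polarPoint b r β)
        = r • (Real.cos (β - m) • u + Real.sin (β - m) • w) := by
      rw [← hL1, ← hL2, ← map_polarPoint, polarPoint_add, add_sub_cancel]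
    have h4 : ‖f (polarPoint b r β) - L (polarPoint b r β)‖ ^ 2 = 0 := by
      rw [@norm_sub_sq_real, hf.norm_map, L.norm_map, norm_polarPoint b hr.le, hLβ,
        inner_smul_right, inner_add_right, inner_smul_right, inner_smul_right, h1, h3]
      linear_combination (-2 * r ^ 2) * Real.sin_sq_add_cos_sq (β - m)
    exact sub_eq_zero.1 (norm_eq_zero.1 (pow_eq_zero_iff two_ne_zero |>.1 h4))
  have hcl := hopen.closure (hf.continuous.comp (by fun_prop)) (L.continuous.comp (by fun_prop))
  rw [closure_Ioo hpq.ne] at hcl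
  exact hcl hβ

/-- The linear parts of `f` just counterclockwise and just clockwise of the direction `c`. -/
structure HasSides (f : ℂ → Space) (c : Circle) (δ : ℝ) (L R : ℂ →ₗᵢ[ℝ] Space) : Prop where
  pos : 0 < δ
  lt_pi : δ < Real.pi
  left : ∀ r : ℝ, 0 ≤ r → ∀ β ∈ Set.Icc 0 δ, f (polarPoint c r β) = L (polarPoint c r β)
  right : ∀ r : ℝ, 0 ≤ r → ∀ β ∈ Set.Icc (-δ) 0, f (polarPoint c r β) = R (polarPoint c r β)

lemma HasSides.eq_left {c : Circle} {δ : ℝ} {L R : ℂ →ₗᵢ[ℝ] Space} (h : HasSides f c δ L R) :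
    f c = L c := by
  simpa [polarPoint] using h.left 1 zero_le_one 0 ⟨le_rfl, h.pos.le⟩

lemma HasSides.eq_right {c : Circle} {δ : ℝ} {L R : ℂ →ₗᵢ[ℝ] Space} (h : HasSides f c δ L R) :
    f c = R c := by
  simpa [polarPoint] using h.right 1 zero_le_one 0 ⟨by linarith [h.pos], le_rfl⟩

lemma IsConeFolding.exists_hasSides (hf : IsConeFolding C f) (hC : C.Finite) (c : Circle) :
    ∃ δ L R, HasSides f c δ L R ∧ (c ∉ C → L = R) := by
  obtain ⟨δ, hδ, hδπ, hfree⟩ := exists_crease_free hC c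
  by_cases hc : c ∈ C
  · obtain ⟨L, hL⟩ := hf.exists_eq_on_sector c hδ
      fun β hβ => hfree β hβ.1.ne' (by rw [abs_of_pos hβ.1]; exact hβ.2)
    obtain ⟨R, hR⟩ := hf.exists_eq_on_sector c (neg_lt_zero.2 hδ)
      fun β hβ => hfree β hβ.2.ne (by rw [abs_of_neg hβ.2]; linarith [hβ.1])
    exact ⟨δ, L, R, ⟨hδ, hδπ, hL, hR⟩, fun h => absurd hc h⟩
  · obtain ⟨L, hL⟩ := hf.exists_eq_on_sector c (by linarith : -δ < δ) fun β hβ => by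
      rcases eq_or_ne β 0 with rfl | h0
      · simpa using hc
      · exact hfree β h0 (abs_lt.2 hβ)
    exact ⟨δ, L, L, ⟨hδ, hδπ, fun r hr β hβ => hL r hr β ⟨by linarith [hβ.1], hβ.2⟩,
      fun r hr β hβ => hL r hr β ⟨hβ.1, by linarith [hβ.2]⟩⟩, fun _ => rfl⟩

/-- Otherwise directions at equal angles on the two sides of `c` would have the same image, against
injectivity. -/
lemma IsConeFolding.sides_ne_neg (hf : IsConeFolding C f) {c : Circle} {δ : ℝ}
    {L R : ℂ →ₗᵢ[ℝ] Space} (h : HasSides f c δ L R) :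
    L (Complex.I * c) ≠ -R (Complex.I * c) := by
  intro he
  have h1 := h.left 1 zero_le_one δ ⟨h.pos.le, le_rfl⟩
  have h2 := h.right 1 zero_le_one (-δ) ⟨le_rfl, by linarith [h.pos]⟩
  rw [map_polarPoint, ← h.eq_left, he] at h1
  rw [map_polarPoint, ← h.eq_right, Real.sin_neg, Real.cos_neg, neg_smul, ← smul_neg, ← h1] at h2
  have h3 : Complex.arg (polarPoint c 1 (-δ) / c) = Complex.arg (polarPoint c 1 δ / c) := by
    rw [hf.injOn trivial trivial h2]
  rw [arg_polarPoint_div c one_pos (by linarith [h.lt_pi]) (by linarith [h.pos, h.lt_pi]),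
    arg_polarPoint_div c one_pos (by linarith [h.pos, h.lt_pi]) h.lt_pi.le] at h3
  linarith [h.pos]

lemma IsConeFolding.sign_det_of_hasFoldingAngle (hf : IsConeFolding C f) {c : Circle} {δ θ : ℝ}
    {L R : ℂ →ₗᵢ[ℝ] Space} (h : HasSides f c δ L R) (hθ : HasFoldingAngle Set.univ f c θ) :
    (0 < θ → 0 < det3 (R c) (R (Complex.I * c)) (L (Complex.I * c))) ∧
      (θ < 0 → det3 (R c) (R (Complex.I * c)) (L (Complex.I * c)) < 0) := by
  obtain ⟨L', R', ⟨ε, hε, hLR⟩, h1, h2, h3, h4⟩ := hθ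
  obtain ⟨τ, hτ, hτε, hτδ⟩ : ∃ τ, 0 < τ ∧ τ < ε ∧ τ < δ :=
    ⟨min ε δ / 2, by have := lt_min hε h.pos; linarith,
      by have := lt_min hε h.pos; linarith [min_le_left ε δ],
      by have := lt_min hε h.pos; linarith [min_le_right ε δ]⟩
  have hπ := h.lt_pi
  have hargs : ∀ β, |β| ≤ τ → Complex.arg (polarPoint c 1 β / c) = β := fun β hβ => by
    rw [abs_le] at hβ
    exact arg_polarPoint_div c one_pos (by linarith) (by linarith)
  have hL : ∀ β, 0 < β → β ≤ τ → L' (polarPoint c 1 β) = L (polarPoint c 1 β) := by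
    intro β h0 hβ
    have := (hLR (polarPoint c 1 β) trivial).1
    rw [hargs β (by rwa [abs_of_pos h0]), hf.map_zero, zero_add] at this
    rw [← this h0 (by linarith), h.left 1 zero_le_one β ⟨h0.le, by linarith⟩]
  have hR : ∀ β, β < 0 → -τ ≤ β → R' (polarPoint c 1 β) = R (polarPoint c 1 β) := by
    intro β h0 hβ
    have := (hLR (polarPoint c 1 β) trivial).2
    rw [hargs β (by rw [abs_of_neg h0]; linarith), hf.map_zero, zero_add] at this
    rw [← this (by linarith) h0, h.right 1 zero_le_one β ⟨by linarith, h0.le⟩]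
  -- The maps `L'`, `R'` from the definition of the folding angle agree with `L`, `R` at two
  -- independent directions on each side, hence wherever they enter the angle.
  have hs : Real.sin (τ / 2) ≠ 0 := (Real.sin_pos_of_pos_of_lt_pi (by linarith) (by linarith)).ne'
  obtain ⟨-, eL⟩ := linearIsometry_eq_of_two (α := τ / 2) (β := τ) (by rwa [sub_half])
    (hL _ (by linarith) (by linarith)) (hL _ hτ le_rfl)
  obtain ⟨eR1, eR2⟩ := linearIsometry_eq_of_two (α := -τ) (β := -(τ / 2))
    (by rwa [show -(τ / 2) - -τ = τ / 2 by ring])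
    (hR _ (by linarith) le_rfl) (hR _ (by linarith) (by linarith))
  rw [eR2, eL] at h3 h4
  rw [eR1] at h4
  have h4' : Real.sin θ = det3 (R c) (R (Complex.I * c)) (L (Complex.I * c)) := h4
  rw [← h4']
  refine ⟨fun h0 => Real.sin_pos_of_pos_of_lt_pi h0 (lt_of_le_of_ne h2 ?_),
    fun h0 => Real.sin_neg_of_neg_of_neg_pi_lt h0 h1⟩
  -- The definition admits the angle `π`, whose sine has no sign; there the two faces would lie on
  -- each other.
  rintro rfl
  rw [Real.cos_pi, real_inner_comm] at h3
  refine hf.sides_ne_neg h ((inner_eq_neg_one_iff_of_norm_eq_one ?_ ?_).1 h3.symm) <;>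
    rw [LinearIsometry.norm_map, norm_mul, Complex.norm_I, Circle.norm_coe, one_mul]

/-- `L (Complex.I * c)` is a unit vector orthogonal to the image of `c`. Its coordinates `x`, `y` in
that normal plane form a unit complex number whose argument is the folding angle. -/
lemma HasSides.exists_hasFoldingAngle {c : Circle} {δ : ℝ} {L R : ℂ →ₗᵢ[ℝ] Space}
    (h : HasSides f c δ L R) :
    ∃ θ, HasFoldingAngle Set.univ f c θ ∧
      Real.sin θ = det3 (R c) (R (Complex.I * c)) (L (Complex.I * c)) ∧
      (L = R → θ = 0) := by
  have hLR : L c = R c := h.eq_left.symm.trans h.eq_right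
  have hn1 : ∀ M : ℂ →ₗᵢ[ℝ] Space, ‖M c‖ = 1 := fun M => by
    rw [M.norm_map, Circle.norm_coe]
  have hn2 : ∀ M : ℂ →ₗᵢ[ℝ] Space, ‖M (Complex.I * c)‖ = 1 := fun M => by
    rw [M.norm_map, norm_mul, Complex.norm_I, Circle.norm_coe, one_mul]
  have horth : ∀ M : ℂ →ₗᵢ[ℝ] Space, inner ℝ (M c) (M (Complex.I * c)) = 0 := fun M => by
    rw [M.inner_map_map, inner_circle_I_mul]
  have hsq := norm_sq_eq_of_orthonormal (hn1 R) (hn2 R) (horth R) (L (Complex.I * c))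
  rw [hn2 L, ← hLR, horth L, hLR] at hsq
  have hdet : det3 (R c) (R (Complex.I * c)) (L (Complex.I * c)) =
      inner ℝ (cross (R c) (R (Complex.I * c))) (L (Complex.I * c)) := by
    rw [det3_eq, inner_cross_rotate, inner_cross_rotate, real_inner_comm]
  rw [← hdet] at hsq
  set x := inner ℝ (R (Complex.I * c)) (L (Complex.I * c)) with hx
  set y := det3 (R c) (R (Complex.I * c)) (L (Complex.I * c)) with hy
  have hnorm : ‖(⟨x, y⟩ : ℂ)‖ = 1 := by
    rw [← sq_eq_sq₀ (norm_nonneg _) zero_le_one, Complex.sq_norm, Complex.normSq_apply]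
    linear_combination -hsq
  have hne : (⟨x, y⟩ : ℂ) ≠ 0 := by rw [← norm_ne_zero_iff, hnorm]; exact one_ne_zero
  have hcos : Real.cos (Complex.arg ⟨x, y⟩) = x := by
    rw [Complex.cos_arg hne, hnorm, div_one]
  have hsin : Real.sin (Complex.arg ⟨x, y⟩) = y := by
    rw [Complex.sin_arg, hnorm, div_one]
  have hf0 : f 0 = 0 := by
    simpa [polarPoint] using h.left 0 le_rfl 0 ⟨le_rfl, h.pos.le⟩
  refine ⟨Complex.arg ⟨x, y⟩, ⟨L, R, ⟨δ, h.pos, fun z _ => ⟨fun h1 h2 => ?_, fun h1 h2 => ?_⟩⟩,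
    Complex.neg_pi_lt_arg _, Complex.arg_le_pi _, hcos, hsin⟩, hsin, ?_⟩
  · rw [hf0, zero_add]
    have := h.left ‖z‖ (norm_nonneg _) _ ⟨h1.le, h2.le⟩
    rwa [← eq_polarPoint] at this
  · rw [hf0, zero_add]
    have := h.right ‖z‖ (norm_nonneg _) _ ⟨h1.le, h2.le⟩
    rwa [← eq_polarPoint] at this
  · intro he
    have hx1 : x = 1 := by rw [hx, he, real_inner_self_eq_norm_sq, hn2, one_pow]
    have hy0 : y = 0 := by rw [hdet, he, real_inner_comm, inner_cross_self]
    rw [hx1, hy0]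
    exact Complex.arg_one

end Sector

/-! ### The crease images span space. -/

section Spanning

variable {C : Set Circle} {f : ℂ → Space}

/-- Cramer's rule; it is used to see that a nonzero `w` cannot be orthogonal to three vectors with
nonzero determinant. -/
lemma det3_smul_eq (a b c w : Space) : det3 a b c • w =
    (inner ℝ a w : ℝ) • cross b c + (inner ℝ b w : ℝ) • cross c a +
      (inner ℝ c w : ℝ) • cross a b := by
  rw [det3_eq]
  apply ext_three <;>
    simp only [cross_apply_zero, cross_apply_one, cross_apply_two, PiLp.add_apply,
        PiLp.smul_apply, smul_eq_mul, inner_eq_sum] <;> ring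

lemma exp_mul_injOn (c : Circle) {s : ℝ} (hs : s = 1 ∨ s = -1) :
    Set.InjOn (fun β : ℝ => Circle.exp (s * β) * c) (Set.Ioo 0 (2 * Real.pi)) := by
  intro α hα β hβ h
  by_contra hne
  have h1 : Circle.exp (s * α - s * β) * c = c := by
    have h' : Circle.exp (s * α) * c = Circle.exp (s * β) * c := h
    rw [Circle.exp_sub, div_mul_eq_mul_div, h', mul_div_cancel_left]
  refine exp_mul_ne_self c ?_ ?_ h1
  · rcases hs with rfl | rfl <;> intro h0 <;> apply hne <;> linarith
  · rcases hs with rfl | rfl <;> rw [abs_lt] <;> constructor <;> linarith [hα.1, hα.2, hβ.1, hβ.2]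

lemma exists_exp_mul_eq (c d : Circle) :
    ∃ β, -Real.pi < β ∧ β ≤ Real.pi ∧ Circle.exp β * c = d := by
  refine ⟨Complex.arg (d / c), Complex.neg_pi_lt_arg _, Complex.arg_le_pi _, ?_⟩
  ext
  have h := eq_polarPoint c d
  rw [Circle.norm_coe, polarPoint, Complex.ofReal_one, one_mul] at h
  exact h.symm

/-- If all creases are mapped into the plane orthogonal to `w`, and the folding leaves this plane
on one side of the crease `c`, then the next crease on that side is opposite to `c`. -/
lemma IsConeFolding.next_crease (hf : IsConeFolding C f) (hC : C.Finite) {w : Space}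
    (hw : ∀ d ∈ C, inner ℝ w (f d) = 0) {c d : Circle} (hc : c ∈ C) (hd : d ∈ C) (hcd : d ≠ c)
    {s : ℝ} (hs : s = 1 ∨ s = -1) {L : ℂ →ₗᵢ[ℝ] Space} {δ : ℝ} (hδ : 0 < δ) (hLc : f c = L c)
    (hL : ∀ β ∈ Set.Icc 0 δ, f (polarPoint c 1 (s * β)) = L (polarPoint c 1 (s * β)))
    (hne : inner ℝ w (L (Complex.I * c)) ≠ 0) :
    Circle.exp Real.pi * c ∈ C ∧ ∀ β ∈ Set.Ioo 0 Real.pi, Circle.exp (s * β) * c ∉ C := by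
  have hπ := Real.pi_pos
  let B := {β : ℝ | β ∈ Set.Ioo 0 (2 * Real.pi) ∧ Circle.exp (s * β) * c ∈ C}
  have hBfin : B.Finite := Set.Finite.of_finite_image (f := fun β : ℝ => Circle.exp (s * β) * c)
    (hC.subset (by rintro _ ⟨β, hβ, rfl⟩; exact hβ.2))
    ((exp_mul_injOn c hs).mono fun β hβ => hβ.1)
  have hBne : B.Nonempty := by
    obtain ⟨β, h1, h2, h3⟩ := exists_exp_mul_eq c d
    have h0 : β ≠ 0 := by rintro rfl; simp at h3; exact hcd h3.symm
    have hper : ∀ x : ℝ, Circle.exp (x + 2 * Real.pi) = Circle.exp x := fun x => by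
      rw [Circle.exp_add, Circle.exp_two_pi, mul_one]
    rcases hs with rfl | rfl <;> rcases h0.lt_or_gt with h0 | h0
    · exact ⟨β + 2 * Real.pi, ⟨by linarith, by linarith⟩, by rwa [one_mul, hper, h3]⟩
    · exact ⟨β, ⟨by linarith, by linarith⟩, by rwa [one_mul, h3]⟩
    · exact ⟨-β, ⟨by linarith, by linarith⟩, by rwa [neg_one_mul, neg_neg, h3]⟩
    · refine ⟨2 * Real.pi - β, ⟨by linarith, by linarith⟩, ?_⟩
      rwa [← hper, show -1 * (2 * Real.pi - β) + 2 * Real.pi = β by ring, h3]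
  obtain ⟨β₀, hβ₀, hmin⟩ := hBfin.exists_minimal hBne
  have hmin' : ∀ β, 0 < β → β < β₀ → Circle.exp (s * β) * c ∉ C := fun β h0 hβ hm =>
    absurd (hmin ⟨⟨h0, hβ.trans hβ₀.1.2⟩, hm⟩ hβ.le) (not_le.2 hβ)
  obtain ⟨M, hM⟩ : ∃ M : ℂ →ₗᵢ[ℝ] Space, ∀ β ∈ Set.Icc 0 β₀,
      f (polarPoint c 1 (s * β)) = M (polarPoint c 1 (s * β)) := by
    rcases hs with rfl | rfl
    · obtain ⟨M, hM⟩ := hf.exists_eq_on_sector c hβ₀.1.1 fun β hβ => by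
        simpa using hmin' β hβ.1 hβ.2
      exact ⟨M, fun β hβ => hM 1 zero_le_one _ (by simpa using hβ)⟩
    · obtain ⟨M, hM⟩ := hf.exists_eq_on_sector c (neg_lt_zero.2 hβ₀.1.1) fun β hβ => by
        simpa using hmin' (-β) (by linarith [hβ.2]) (by linarith [hβ.1])
      exact ⟨M, fun β hβ => hM 1 zero_le_one _ (by simpa [and_comm] using hβ)⟩
  obtain ⟨τ, hτ, hτδ, hτβ, hτπ⟩ : ∃ τ, 0 < τ ∧ τ ≤ δ ∧ τ ≤ β₀ ∧ τ < Real.pi :=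
    ⟨min (min δ β₀) (Real.pi / 2), by have := hβ₀.1.1; positivity,
      (min_le_left _ _).trans (min_le_left _ _), (min_le_left _ _).trans (min_le_right _ _),
      (min_le_right _ _).trans_lt (by linarith)⟩
  have hsτ : Real.sin τ ≠ 0 := (Real.sin_pos_of_pos_of_lt_pi hτ hτπ).ne'
  have hML : M c = L c ∧ M (Complex.I * c) = L (Complex.I * c) := by
    refine linearIsometry_eq_of_two (α := s * 0) (β := s * τ) ?_ ?_ ?_
    · rcases hs with rfl | rfl <;> simpa using hsτ
    · rw [← hM 0 ⟨le_rfl, hβ₀.1.1.le⟩, hL 0 ⟨le_rfl, hδ.le⟩]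
    · rw [← hM τ ⟨hτ.le, hτβ⟩, hL τ ⟨hτ.le, hτδ⟩]
  have hend := hM β₀ ⟨hβ₀.1.1.le, le_rfl⟩
  have hin := hw _ hβ₀.2
  have hcoe : ((Circle.exp (s * β₀) * c : Circle) : ℂ) = polarPoint c 1 (s * β₀) := by
    simp [polarPoint]
  -- The image of the next crease is a combination of `f c` and `L (Complex.I * c)`. Pairing it with
  -- `w` leaves only the sine term, so `sin (s * β₀) = 0`.
  rw [hcoe, hend, map_polarPoint, hML.1, hML.2, one_smul, inner_add_right, inner_smul_right,
    inner_smul_right, ← hLc, hw c hc, mul_zero, zero_add] at hin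
  have hsin : Real.sin β₀ = 0 := by
    have := (mul_eq_zero.1 hin).resolve_right hne
    rcases hs with rfl | rfl <;> simpa using this
  have hβπ : β₀ = Real.pi := by
    rcases lt_trichotomy β₀ Real.pi with h | h | h
    · exact absurd hsin (Real.sin_pos_of_pos_of_lt_pi hβ₀.1.1 h).ne'
    · exact h
    · have := Real.sin_neg_of_neg_of_neg_pi_lt (x := β₀ - 2 * Real.pi) (by linarith [hβ₀.1.2])
        (by linarith)
      rw [Real.sin_sub_two_pi] at this
      exact absurd hsin this.ne
  subst hβπ
  refine ⟨?_, fun β hβ => hmin' β hβ.1 hβ.2⟩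
  have hm := hβ₀.2
  rcases hs with rfl | rfl
  · rwa [one_mul] at hm
  · rwa [neg_one_mul, show -Real.pi = Real.pi - 2 * Real.pi by ring, Circle.exp_sub,
      Circle.exp_two_pi, div_one] at hm

lemma exists_linearIndependent_triple {S : Set Space} (hS : Submodule.span ℝ S = ⊤) :
    ∃ v : Fin 3 → Space, (∀ i, v i ∈ S) ∧ LinearIndependent ℝ v := by
  obtain ⟨b, hbS, hspan, hli⟩ := exists_linearIndependent ℝ S
  let B := Module.Basis.mk hli (by rw [Subtype.range_coe, hspan, hS])
  have hfin : Finite b := Module.Finite.finite_basis B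
  have hcard : Nat.card b = 3 := by
    rw [← Module.finrank_eq_nat_card_basis B]
    simp
  let e : Fin 3 ≃ b := (Finite.equivFinOfCardEq hcard).symm
  exact ⟨fun i => e i, fun i => hbS (e i).2, hli.comp e e.injective⟩

lemma exists_third {C : Set Circle} (hcard : 2 < C.ncard) (x y : Circle) :
    ∃ d ∈ C, d ≠ x ∧ d ≠ y := by
  by_contra! h
  have hsub : C ⊆ {x, y} := fun d hd => by
    by_cases hx : d = x
    · exact Or.inl hx
    · exact Or.inr (h d hd hx)
  have := (Set.ncard_le_ncard hsub).trans (Set.ncard_insert_le x {y})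
  rw [Set.ncard_singleton] at this
  omega

/-- More than two directions cannot all have their opposites among them and an open half plane
free of directions on one side. -/
lemma false_of_forall_opposite {C : Set Circle} (hcard : 2 < C.ncard)
    (key : ∀ c ∈ C, Circle.exp Real.pi * c ∈ C ∧ ∃ s : ℝ, (s = 1 ∨ s = -1) ∧
      ∀ β ∈ Set.Ioo 0 Real.pi, Circle.exp (s * β) * c ∉ C) : False := by
  obtain ⟨c, hc, -⟩ := exists_third hcard 1 1
  obtain ⟨d, hd, hdc, hdc'⟩ := exists_third hcard c (Circle.exp Real.pi * c)
  obtain ⟨β, h1, h2, hβ⟩ := exists_exp_mul_eq c d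
  have h0 : β ≠ 0 := by
    intro h
    rw [h, Circle.exp_zero, one_mul] at hβ
    exact hdc hβ.symm
  have hπ : β ≠ Real.pi := by
    intro h
    rw [h] at hβ
    exact hdc' hβ.symm
  have h2' : β < Real.pi := lt_of_le_of_ne h2 hπ
  -- The crease `d` and its opposite lie strictly on different sides of the line through `c`, so
  -- neither half plane at `c` is free.
  have hopp := (key _ hd).1
  rw [← hβ, ← mul_assoc, ← Circle.exp_add] at hopp
  rw [← hβ] at hd
  obtain ⟨-, s, hs, hfree⟩ := key c hc
  rcases hs with hs | hs <;> rw [hs] at hfree <;> rcases h0.lt_or_gt with h0 | h0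
  · exact hfree (Real.pi + β) ⟨by linarith, by linarith⟩ (by rwa [one_mul])
  · exact hfree β ⟨h0, h2'⟩ (by rwa [one_mul])
  · exact hfree (-β) ⟨by linarith, by linarith⟩ (by rwa [neg_one_mul, neg_neg])
  · refine hfree (Real.pi - β) ⟨by linarith, by linarith⟩ ?_
    rwa [show -1 * (Real.pi - β) = Real.pi + β - 2 * Real.pi by ring, Circle.exp_sub,
      Circle.exp_two_pi, div_one]

/-- As the crease is folded, its two adjacent faces span space together, so at least one of them is
not orthogonal to `w`; `IsConeFolding.next_crease` applies on that side. -/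
lemma IsConeFolding.opposite_crease (hf : IsConeFolding C f) (hC : C.Finite) {w : Space}
    (hw0 : w ≠ 0) (hw : ∀ d ∈ C, inner ℝ w (f d) = 0) {c d : Circle} (hc : c ∈ C) (hdC : d ∈ C)
    (hdc : d ≠ c) {δ : ℝ} {L R : ℂ →ₗᵢ[ℝ] Space} (h : HasSides f c δ L R)
    (hd : det3 (R c) (R (Complex.I * c)) (L (Complex.I * c)) ≠ 0) :
    Circle.exp Real.pi * c ∈ C ∧ ∃ s : ℝ, (s = 1 ∨ s = -1) ∧
      ∀ β ∈ Set.Ioo 0 Real.pi, Circle.exp (s * β) * c ∉ C := by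
  by_cases hLw : inner ℝ w (L (Complex.I * c)) = 0
  · have hRw : inner ℝ w (R (Complex.I * c)) ≠ 0 := by
      intro hRw
      have h3 := det3_smul_eq (R c) (R (Complex.I * c)) (L (Complex.I * c)) w
      rw [real_inner_comm w, real_inner_comm w, real_inner_comm w, hRw, hLw, ← h.eq_right, hw c hc,
        zero_smul, zero_smul, zero_smul, add_zero, add_zero, h.eq_right] at h3
      exact (smul_ne_zero hd hw0) h3
    obtain ⟨h1, h2⟩ := hf.next_crease hC hw hc hdC hdc (Or.inr rfl) h.pos h.eq_right
      (fun β hβ => h.right 1 zero_le_one _ ⟨by linarith [hβ.2], by linarith [hβ.1]⟩) hRw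
    exact ⟨h1, -1, Or.inr rfl, h2⟩
  · obtain ⟨h1, h2⟩ := hf.next_crease hC hw hc hdC hdc (Or.inl rfl) h.pos h.eq_left
      (fun β hβ => h.left 1 zero_le_one _ (by rwa [one_mul])) hLw
    exact ⟨h1, 1, Or.inl rfl, h2⟩

/-- The images of the creases of a folding with at least three creases, all of them folded, are
not contained in a plane. -/
lemma IsConeFolding.exists_independent_creases (hf : IsConeFolding C f) (hC : C.Finite)
    (hcard : 2 < C.ncard)
    (hdet : ∀ c ∈ C, ∃ δ L R, HasSides f c δ L R ∧
      det3 (R c) (R (Complex.I * c)) (L (Complex.I * c)) ≠ 0) :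
    ∃ c : Fin 3 → Circle, (∀ i, c i ∈ C) ∧ LinearIndependent ℝ fun i => f (c i) := by
  by_cases hS : Submodule.span ℝ ((fun c : Circle => f c) '' C) = ⊤
  · obtain ⟨v, hv, hli⟩ := exists_linearIndependent_triple hS
    choose c hc hcv using hv
    have hv : v = fun i => f (c i) := funext fun i => (hcv i).symm
    exact ⟨c, hc, hv ▸ hli⟩
  · rw [← Submodule.orthogonal_eq_bot_iff] at hS
    obtain ⟨w, hwm, hw0⟩ := (Submodule.ne_bot_iff _).1 hS
    have hw : ∀ d ∈ C, inner ℝ w (f d) = 0 := by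
      intro d hd
      have hm : f d ∈ (fun c : Circle => f c) '' C := ⟨d, hd, rfl⟩
      exact Submodule.inner_left_of_mem_orthogonal (Submodule.subset_span hm) hwm
    refine (false_of_forall_opposite hcard fun c hc => ?_).elim
    obtain ⟨δ, L, R, h, hd⟩ := hdet c hc
    obtain ⟨d, hdC, hdc, -⟩ := exists_third hcard c c
    exact hf.opposite_crease hC hw0 hw hc hdC hdc h hd

end Spanning

/-! ### Bending the cut paper at three hinges. -/

/-- `rot3` as an isometry. -/
noncomputable def rot3Isometry {u : Fin 3 → Space} (hu : ∀ i, ‖u i‖ = 1) (θ : Fin 3 → ℝ) :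
    Space →ₗᵢ[ℝ] Space :=
  ⟨(rot3 u θ : Space →ₗ[ℝ] Space), norm_rot3 hu θ⟩

lemma rot3Isometry_comp_apply {u : Fin 3 → Space} (hu : ∀ i, ‖u i‖ = 1) (θ : Fin 3 → ℝ)
    (L : ℂ →ₗᵢ[ℝ] Space) (x : ℂ) :
    ((rot3Isometry hu θ).comp L) x = rot3 u θ (L x) := rfl

/-- The indicator of the hinges passed before the angle `t`. -/
noncomputable def hingeStep (s : Fin 3 → ℝ) (t : ℝ) (i : Fin 3) : ℝ := if t ≤ s i then 0 else 1

/-- The indicator of the hinges passed before or at the angle `t`. -/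
noncomputable def hingeStepRight (s : Fin 3 → ℝ) (t : ℝ) (i : Fin 3) : ℝ := if t < s i then 0 else 1

lemma eventually_hingeStep (s : Fin 3 → ℝ) (t : ℝ) : ∀ᶠ ε in 𝓝 (0 : ℝ),
    -- The width `ε` has to be smaller than the distance from `t` to every other hinge; a hinge at
    -- `t` itself is passed only for positive `β`.
    (∀ β, 0 < β → β ≤ ε → hingeStep s (t + β) = hingeStepRight s t) ∧
    (∀ β, -ε ≤ β → β ≤ 0 → hingeStep s (t + β) = hingeStep s t) := by
  have h : ∀ᶠ ε in 𝓝 (0 : ℝ), ∀ i, s i ≠ t → ε < |s i - t| := by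
    refine Filter.eventually_all.2 fun i => ?_
    by_cases hi : s i = t
    · simp [hi]
    · filter_upwards [Iio_mem_nhds (abs_pos.2 (sub_ne_zero.2 hi))] with ε hε _ using hε
  filter_upwards [h] with ε hε
  refine ⟨fun β h0 hβ => funext fun i => ?_, fun β hβ h0 => funext fun i => ?_⟩
  · simp only [hingeStep, hingeStepRight]
    rcases lt_trichotomy (s i) t with h | h | h
    · rw [if_neg (by linarith), if_neg (by linarith)]
    · rw [if_neg (by linarith), if_neg (by linarith)]
    · have := hε i h.ne'
      rw [abs_of_pos (by linarith)] at this
      rw [if_pos (by linarith), if_pos (by linarith)]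
  · simp only [hingeStep]
    rcases lt_trichotomy (s i) t with h | h | h
    · have := hε i h.ne
      rw [abs_of_neg (by linarith)] at this
      rw [if_neg (by linarith), if_neg (by linarith)]
    · rw [if_pos (by linarith), if_pos (by linarith)]
    · rw [if_pos (by linarith), if_pos (by linarith)]

lemma hingeStep_eq_one {s : Fin 3 → ℝ} {t : ℝ} (h : ∀ i, s i < t) : hingeStep s t = 1 :=
  funext fun i => if_neg (not_le.2 (h i))

lemma hingeStepRight_eq_zero {s : Fin 3 → ℝ} {t : ℝ} (h : ∀ i, t < s i) :
    hingeStepRight s t = 0 :=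
  funext fun i => if_pos (h i)

/-- The hinges do not move the points on their own axes. -/
lemma rot3_hingeStep {s : Fin 3 → ℝ} (hs : StrictMono s) {u : Fin 3 → Space}
    (hu : ∀ i, ‖u i‖ = 1) {t : ℝ} {v : Space} (hv : ∀ i, s i = t → v = u i) (θ : Fin 3 → ℝ) :
    rot3 u (hingeStep s t * θ) v = rot3 u (hingeStepRight s t * θ) v := by
  by_cases h : ∃ k, s k = t
  · obtain ⟨k, hk⟩ := h
    have hvk := hv k hk
    have h01 : s 0 < s 1 := hs (by decide)
    have h12 : s 1 < s 2 := hs (by decide)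
    subst hvk hk
    -- On passing hinge `k` the rotation about `u k` is added innermost, after those about the axes
    -- with smaller index. It therefore acts directly on `u k`, which it fixes.
    simp only [rot3_apply, Pi.mul_apply, hingeStep, hingeStepRight]
    fin_cases k
    · simp [h01, h01.le, h01.trans h12, (h01.trans h12).le, rot_self (hu 0)]
    · simp [h01.not_ge, h01.le.not_gt, h12, h12.le, rot_self (hu 1)]
    · simp [h12.not_ge, h12.le.not_gt, (h01.trans h12).not_ge, (h01.trans h12).le.not_gt,
        rot_self (hu 2)]
  · push Not at h
    have : hingeStep s t = hingeStepRight s t := funext fun i => by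
      simp only [hingeStep, hingeStepRight]
      rcases (h i).lt_or_gt with hi | hi
      · rw [if_neg (by linarith), if_neg (by linarith)]
      · rw [if_pos (by linarith), if_pos (by linarith)]
    rw [this]

/-- The map obtained from `f` by turning, for each `i`, the part of the paper beyond the angle `s i`
from the direction `b` about the axis `u i` through the angle `θ i`. -/
noncomputable def bend (f : ℂ → Space) (b : Circle) (s : Fin 3 → ℝ) (u : Fin 3 → Space)
    (θ : Fin 3 → ℝ) (x : ℂ) : Space :=
  rot3 u (hingeStep s (Complex.arg (x / b)) * θ) (f x)

section Bend

variable {C : Set Circle} {f : ℂ → Space} {b c' : Circle} {s : Fin 3 → ℝ} {u : Fin 3 → Space}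

lemma bend_zero (x : ℂ) : bend f b s u 0 x = f x := by simp [bend]

lemma norm_bend (hf : IsConeFolding C f) (hu : ∀ i, ‖u i‖ = 1) (θ : Fin 3 → ℝ) (x : ℂ) :
    ‖bend f b s u θ x‖ = ‖x‖ := by
  rw [bend, norm_rot3 hu, hf.norm_map]

lemma bend_smul (hf : IsConeFolding C f) (θ : Fin 3 → ℝ) {t : ℝ} (ht : 0 < t) (x : ℂ) :
    bend f b s u θ (t • x) = t • bend f b s u θ x := by
  have : Complex.arg (t • x / (b : ℂ)) = Complex.arg (x / b) := by
    rw [Complex.real_smul, mul_div_assoc, Complex.arg_real_mul _ ht]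
  rw [bend, this, hf.map_smul t ht.le, map_smul, bend]

lemma bend_polarPoint {t : ℝ} (h1 : -Real.pi < t) (h2 : t ≤ Real.pi) {r : ℝ} (hr : 0 < r)
    (θ : Fin 3 → ℝ) : bend f b s u θ (polarPoint b r t) =
      rot3 u (hingeStep s t * θ) (f (polarPoint b r t)) := by
  rw [bend, arg_polarPoint_div b hr h1 h2]

/-- The data for bending: three hinges in order, away from the cut, which is in the direction `c'`
opposite to `b`. -/
structure IsHinges (C : Set Circle) (f : ℂ → Space) (b c' : Circle) (s : Fin 3 → ℝ)
    (u : Fin 3 → Space) : Prop where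
  opposite : Circle.exp Real.pi * b = c'
  strictMono : StrictMono s
  neg_pi_lt : ∀ i, -Real.pi < s i
  lt_pi : ∀ i, s i < Real.pi
  mem : ∀ i, Circle.exp (s i) * b ∈ C
  axis : ∀ i, f (Circle.exp (s i) * b : Circle) = u i

lemma IsHinges.norm_axis (h : IsHinges C f b c' s u) (hf : IsConeFolding C f) (i : Fin 3) :
    ‖u i‖ = 1 := by
  rw [← h.axis, hf.norm_map, Circle.norm_coe]

lemma IsHinges.hasSides_bend_of_lt (hh : IsHinges C f b c' s u) (hf : IsConeFolding C f)
    (hu : ∀ i, ‖u i‖ = 1) {t : ℝ} (h1 : -Real.pi < t) (h2 : t < Real.pi)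
    {δ : ℝ} {L R : ℂ →ₗᵢ[ℝ] Space} (hs : HasSides f (Circle.exp t * b) δ L R) :
    ∃ ε, ∀ θ : Fin 3 → ℝ, HasSides (bend f b s u θ) (Circle.exp t * b) ε
      ((rot3Isometry hu (hingeStepRight s t * θ)).comp L)
      ((rot3Isometry hu (hingeStep s t * θ)).comp R) := by
  -- Besides the hinge gaps, `ε` keeps `t + β` inside `(-π, π)`, away from the jump of the argument.
  -- It does not depend on `θ`.
  obtain ⟨ε, ⟨hε1, hε2⟩, hε⟩ := (((eventually_hingeStep s t).filter_mono
    nhdsWithin_le_nhds).and (Ioo_mem_nhdsGT (lt_min hs.pos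
      (lt_min (by linarith : 0 < Real.pi - t) (by linarith : 0 < t + Real.pi))))).exists
  have hεδ := hε.2.trans_le (min_le_left _ _)
  have hεt1 := hε.2.trans_le ((min_le_right _ _).trans (min_le_left _ _))
  have hεt2 := hε.2.trans_le ((min_le_right _ _).trans (min_le_right _ _))
  refine ⟨ε, fun θ => ⟨hε.1, hεδ.trans hs.lt_pi, fun r hr β hβ => ?_, fun r hr β hβ => ?_⟩⟩
  · have hL := hs.left r hr β ⟨hβ.1, hβ.2.trans hεδ.le⟩
    rw [rot3Isometry_comp_apply, ← hL]
    rcases hr.eq_or_lt with rfl | hr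
    · simp [polarPoint, bend, hf.map_zero]
    rw [polarPoint_add, bend_polarPoint (by linarith [hβ.1]) (by linarith [hβ.2]) hr]
    rcases hβ.1.eq_or_lt with rfl | h0
    · rw [add_zero, polarPoint_eq_smul, hf.map_smul r hr.le, map_smul, map_smul,
        rot3_hingeStep hh.strictMono hu]
      rintro i rfl
      exact hh.axis i
    · rw [hε1 β h0 hβ.2]
  · have hR := hs.right r hr β ⟨by linarith [hβ.1], hβ.2⟩
    rw [rot3Isometry_comp_apply, ← hR]
    rcases hr.eq_or_lt with rfl | hr
    · simp [polarPoint, bend, hf.map_zero]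
    rw [polarPoint_add, bend_polarPoint (by linarith [hβ.1]) (by linarith [hβ.2]) hr,
      hε2 β hβ.1 hβ.2]

/-- The direction `c'` is where the argument relative to `b` jumps: just counterclockwise no hinge
has been passed, just clockwise all three have. The two sides fit together exactly because the total
rotation fixes `f c'`. -/
lemma IsHinges.hasSides_bend_opposite (hh : IsHinges C f b c' s u) (hf : IsConeFolding C f)
    (hu : ∀ i, ‖u i‖ = 1) {δ : ℝ} {L R : ℂ →ₗᵢ[ℝ] Space} (hs : HasSides f c' δ L R) :
    ∃ ε, ∀ θ : Fin 3 → ℝ, rot3 u θ (f c') = f c' → HasSides (bend f b s u θ) c' ε L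
      ((rot3Isometry hu θ).comp R) := by
  have hπ := Real.pi_pos
  obtain ⟨ε, ⟨⟨hε1, -⟩, -, hε2⟩, hε⟩ := ((((eventually_hingeStep s (-Real.pi)).and
    (eventually_hingeStep s Real.pi)).filter_mono
    nhdsWithin_le_nhds).and (Ioo_mem_nhdsGT hs.pos)).exists
  rw [hingeStepRight_eq_zero hh.neg_pi_lt] at hε1
  rw [hingeStep_eq_one hh.lt_pi] at hε2
  have hεπ := hε.2.trans hs.lt_pi
  refine ⟨ε, fun θ hθ => ⟨hε.1, hεπ, fun r hr β hβ => ?_, fun r hr β hβ => ?_⟩⟩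
  · rw [← hs.left r hr β ⟨hβ.1, hβ.2.trans hε.2.le⟩]
    rcases hr.eq_or_lt with rfl | hr
    · simp [polarPoint, bend, hf.map_zero]
    rcases hβ.1.eq_or_lt with rfl | h0
    -- On `c'` itself the argument is `π`, so the full rotation applies and the closing condition
    -- `hθ` is needed.
    · nth_rw 1 [← hh.opposite]
      rw [polarPoint_add, add_zero, bend_polarPoint (by linarith) le_rfl hr,
        hingeStep_eq_one hh.lt_pi, one_mul, polarPoint_eq_smul, hh.opposite, polarPoint_zero_angle,
        ← Complex.real_smul, hf.map_smul r hr.le, map_smul, hθ]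
    · have hc : c' = Circle.exp (-Real.pi) * b := by
        rw [← hh.opposite, show -Real.pi = Real.pi - 2 * Real.pi by ring, Circle.exp_sub,
          Circle.exp_two_pi, div_one]
      rw [hc, polarPoint_add, bend_polarPoint (by linarith) (by linarith [hβ.2]) hr,
        hε1 β h0 hβ.2, zero_mul, rot3_zero]
  · have hR := hs.right r hr β ⟨by linarith [hβ.1, hε.2], hβ.2⟩
    rw [rot3Isometry_comp_apply, ← hR]
    rcases hr.eq_or_lt with rfl | hr
    · simp [polarPoint, bend, hf.map_zero]
    nth_rw 1 2 [← hh.opposite]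
    rw [polarPoint_add, bend_polarPoint (by linarith [hβ.1]) (by linarith [hβ.2]) hr,
      hε2 β hβ.1 hβ.2, one_mul]

/-- The sides of the bent map at any direction arise from those of `f` by rotations that depend
continuously on the bending angles. -/
lemma IsHinges.exists_hasSides_bend (hh : IsHinges C f b c' s u) (hf : IsConeFolding C f)
    (hu : ∀ i, ‖u i‖ = 1) {c : Circle} {δ : ℝ} {L R : ℂ →ₗᵢ[ℝ] Space} (hs : HasSides f c δ L R) :
    ∃ ε, ∃ e e' : Fin 3 → ℝ, ∀ θ : Fin 3 → ℝ, rot3 u θ (f c') = f c' →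
      HasSides (bend f b s u θ) c ε ((rot3Isometry hu (e * θ)).comp L)
        ((rot3Isometry hu (e' * θ)).comp R) := by
  obtain ⟨t, h1, h2, rfl⟩ := exists_exp_mul_eq b c
  rcases h2.eq_or_lt with rfl | h2
  · rw [hh.opposite] at hs ⊢
    obtain ⟨ε, h⟩ := hh.hasSides_bend_opposite hf hu hs
    refine ⟨ε, 0, 1, fun θ hθ => ?_⟩
    have hL : (rot3Isometry hu (0 * θ)).comp L = L := by
      ext1 x
      rw [rot3Isometry_comp_apply, zero_mul, rot3_zero]
    rw [hL, one_mul]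
    exact h θ hθ
  · obtain ⟨ε, h⟩ := hh.hasSides_bend_of_lt hf hu h1 h2 hs
    exact ⟨ε, _, _, fun θ _ => h θ⟩

lemma eventually_abs_arg_lt {x : ℂ} (hx : x ≠ 0) {c : Circle} (hc : x = ‖x‖ * c) {ε : ℝ}
    (hε : 0 < ε) : ∀ᶠ y in 𝓝 x, |Complex.arg (y / c)| < ε := by
  have hxc : x / c = (‖x‖ : ℂ) := by
    nth_rw 1 [hc]
    exact mul_div_cancel_right₀ _ (Circle.coe_ne_zero c)
  have hcont : ContinuousAt (fun y : ℂ => |Complex.arg (y / c)|) x := by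
    have h1 : ContinuousAt Complex.arg (x / c) := Complex.continuousAt_arg (by
      rw [hxc, Complex.ofReal_mem_slitPlane]; exact norm_pos_iff.2 hx)
    exact (ContinuousAt.comp (f := fun y : ℂ => y / c) h1 (by fun_prop)).abs
  refine hcont.eventually (gt_mem_nhds ?_)
  change |Complex.arg (x / c)| < ε
  rw [hxc, Complex.arg_ofReal_of_nonneg (norm_nonneg _), abs_zero]
  exact hε

variable {a : ℝ → Fin 3 → ℝ}

lemma IsHinges.continuous_bend (hh : IsHinges C f b c' s u) (hf : IsConeFolding C f)
    (hC : C.Finite) (ha : Continuous a) (hfix : ∀ σ, rot3 u (a σ) (f c') = f c') :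
    Continuous fun p : ℝ × ℂ => bend f b s u (a p.1) p.2 := by
  have hu := hh.norm_axis hf
  refine continuous_iff_continuousAt.2 fun ⟨σ, x⟩ => ?_
  rcases eq_or_ne x 0 with rfl | hx
  · have hz : bend f b s u (a σ) 0 = 0 := by simp [bend, hf.map_zero]
    rw [ContinuousAt]
    simp only [hz]
    refine squeeze_zero_norm (a := fun p : ℝ × ℂ => ‖p.2‖) (fun p => (norm_bend hf hu _ _).le) ?_
    have : Continuous fun p : ℝ × ℂ => ‖p.2‖ := by fun_prop
    simpa using this.tendsto (σ, (0 : ℂ))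
  obtain ⟨c, hc⟩ := exists_eq_norm_mul x
  obtain ⟨δ, L, R, hs, -⟩ := hf.exists_hasSides hC c
  obtain ⟨ε, e, e', hb⟩ := hh.exists_hasSides_bend hf hu hs
  have hε := (hb (a σ) (hfix σ)).pos
  have hnear : ∀ᶠ p : ℝ × ℂ in 𝓝 (σ, x), |Complex.arg (p.2 / c)| < ε :=
    (continuous_snd.tendsto (σ, x)).eventually (eventually_abs_arg_lt hx hc hε)
  have hxp : x = polarPoint c ‖x‖ 0 := by rw [polarPoint_zero_angle, ← hc]
  have hL : Filter.Tendsto (fun p : ℝ × ℂ => rot3 u (e * a p.1) (L p.2)) (𝓝 (σ, x))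
      (𝓝 (bend f b s u (a σ) x)) := by
    have hcont : Continuous fun p : ℝ × ℂ => rot3 u (e * a p.1) (L p.2) :=
      continuous_rot3 u (by fun_prop) (L.continuous.comp continuous_snd)
    have := (hb (a σ) (hfix σ)).left ‖x‖ (norm_nonneg _) 0 ⟨le_rfl, hε.le⟩
    rw [← hxp] at this
    rw [this]
    exact hcont.tendsto (σ, x)
  have hR : Filter.Tendsto (fun p : ℝ × ℂ => rot3 u (e' * a p.1) (R p.2)) (𝓝 (σ, x))
      (𝓝 (bend f b s u (a σ) x)) := by
    have hcont : Continuous fun p : ℝ × ℂ => rot3 u (e' * a p.1) (R p.2) :=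
      continuous_rot3 u (by fun_prop) (R.continuous.comp continuous_snd)
    have := (hb (a σ) (hfix σ)).right ‖x‖ (norm_nonneg _) 0 ⟨by linarith, le_rfl⟩
    rw [← hxp] at this
    rw [this]
    exact hcont.tendsto (σ, x)
  classical
  -- Near `x` the bent map is given by one of two jointly continuous formulas, according to the side
  -- of `c`, and both have the value of the map at `(σ, x)` as limit.
  refine (Filter.Tendsto.if' (p := fun p : ℝ × ℂ => 0 ≤ Complex.arg (p.2 / c)) hL hR).congr' ?_
  filter_upwards [hnear] with p hp
  rw [abs_lt] at hp
  have hside := hb (a p.1) (hfix p.1)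
  split_ifs with h0
  · have := hside.left ‖p.2‖ (norm_nonneg _) _ ⟨h0, hp.2.le⟩
    rw [← eq_polarPoint] at this
    exact this.symm
  · have := hside.right ‖p.2‖ (norm_nonneg _) _ ⟨hp.1.le, (not_le.1 h0).le⟩
    rw [← eq_polarPoint] at this
    exact this.symm

/-- Off the creases and the cut the argument is continuous, so its image of `S` is an interval that
avoids the hinge angles. Hence a single rotation acts on the whole of `S`. -/
lemma IsHinges.hingeStep_eq (hh : IsHinges C f b c' s u) {S : Set ℂ} (hS : IsPreconnected S)
    (hSC : S ⊆ Set.univ \ creaseLines (insert c' C)) {x y : ℂ} (hx : x ∈ S) (hy : y ∈ S) :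
    hingeStep s (Complex.arg (x / b)) = hingeStep s (Complex.arg (y / b)) := by
  have h0 : ∀ z ∈ S, z ≠ 0 := by
    rintro z hz rfl
    exact (hSC hz).2 (zero_mem_creaseLines ⟨c', Set.mem_insert _ _⟩)
  have hne : ∀ z ∈ S, ∀ t, Circle.exp t * b ∈ insert c' C → Complex.arg (z / b) ≠ t := by
    intro z hz t ht h
    refine (hSC hz).2 ?_
    rw [eq_polarPoint b z, h, polarPoint_mem_creaseLines_iff (norm_pos_iff.2 (h0 z hz))]
    exact ht
  have hcont : ContinuousOn (fun z : ℂ => Complex.arg (z / b)) S := by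
    intro z hz
    have hm : z / b ∈ Complex.slitPlane := Complex.mem_slitPlane_iff_arg.2
      ⟨hne z hz _ (by rw [hh.opposite]; exact Set.mem_insert _ _),
        div_ne_zero (h0 z hz) (Circle.coe_ne_zero b)⟩
    exact (ContinuousAt.comp (f := fun y : ℂ => y / b) (Complex.continuousAt_arg hm)
      (by fun_prop)).continuousWithinAt
  have hconn := (hS.image _ hcont).ordConnected
  have hle : ∀ z ∈ S, ∀ w ∈ S, ∀ i, Complex.arg (z / b) ≤ s i → Complex.arg (w / b) ≤ s i := by
    intro z hz w hw i hzi
    by_contra! hwi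
    obtain ⟨y, hy, hys⟩ := hconn.out ⟨z, hz, rfl⟩ ⟨w, hw, rfl⟩ ⟨hzi, hwi.le⟩
    exact hne y hy _ (Set.mem_insert_of_mem _ (hh.mem i)) hys
  funext i
  simp only [hingeStep]
  rw [if_congr ⟨hle x hx y hy i, hle y hy x hx i⟩ rfl rfl]

lemma IsHinges.dist_bend (hh : IsHinges C f b c' s u) (hf : IsConeFolding C f) {S : Set ℂ}
    (hS : IsPreconnected S) (hSC : S ⊆ Set.univ \ creaseLines (insert c' C)) (θ : Fin 3 → ℝ)
    {x y : ℂ} (hx : x ∈ S) (hy : y ∈ S) :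
    dist (bend f b s u θ x) (bend f b s u θ y) = dist x y := by
  have hsub : creaseLines C ⊆ creaseLines (insert c' C) :=
    Set.biUnion_subset_biUnion_left (Set.subset_insert _ _)
  rw [bend, bend, hh.hingeStep_eq hS hSC hx hy, dist_eq_norm, ← map_sub,
    norm_rot3 (hh.norm_axis hf), ← dist_eq_norm]
  exact hf.dist_eq_of_isPreconnected hS (fun z hz => ⟨trivial, fun h => (hSC hz).2 (hsub h)⟩) hx hy

/-- The inner product with `g c` is the cosine of the angle and recovers its absolute value.
Opposite angles `γ`, `-γ` have equal images only if the two faces coincide. -/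
lemma HasSides.eq_of_eq {g : ℂ → Space} {c : Circle} {δ : ℝ} {L R : ℂ →ₗᵢ[ℝ] Space}
    (h : HasSides g c δ L R) (hne : L (Complex.I * c) ≠ -R (Complex.I * c)) {α β : ℝ}
    (hα : |α| < δ) (hβ : |β| < δ) (he : g (polarPoint c 1 α) = g (polarPoint c 1 β)) : α = β := by
  have hform : ∀ γ, |γ| < δ → ∃ M : ℂ →ₗᵢ[ℝ] Space, g c = M c ∧
      (0 < γ → M = L) ∧ (γ < 0 → M = R) ∧
      g (polarPoint c 1 γ) = Real.cos γ • M c + Real.sin γ • M (Complex.I * c) := by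
    intro γ hγ
    rw [abs_lt] at hγ
    rcases le_total 0 γ with h0 | h0
    · refine ⟨L, h.eq_left, fun _ => rfl, fun h1 => by linarith, ?_⟩
      rw [h.left 1 zero_le_one γ ⟨h0, hγ.2.le⟩, map_polarPoint, one_smul]
    · refine ⟨R, h.eq_right, fun h1 => by linarith, fun _ => rfl, ?_⟩
      rw [h.right 1 zero_le_one γ ⟨hγ.1.le, h0⟩, map_polarPoint, one_smul]
  have hin : ∀ γ, |γ| < δ → inner ℝ (g c) (g (polarPoint c 1 γ)) = Real.cos γ := by
    intro γ hγ
    obtain ⟨M, hM, -, -, hg⟩ := hform γ hγ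
    rw [hg, hM, inner_add_right, inner_smul_right, inner_smul_right, M.inner_map_map,
      M.inner_map_map, inner_circle_self, inner_circle_I_mul, mul_one, mul_zero, add_zero]
  have hcos : Real.cos |α| = Real.cos |β| := by
    rw [Real.cos_abs, Real.cos_abs, ← hin α hα, he, hin β hβ]
  have habs : |α| = |β| := Real.injOn_cos ⟨abs_nonneg _, (hα.trans h.lt_pi).le⟩
    ⟨abs_nonneg _, (hβ.trans h.lt_pi).le⟩ hcos
  have aux : ∀ γ, 0 < γ → |γ| < δ → g (polarPoint c 1 (-γ)) ≠ g (polarPoint c 1 γ) := by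
    intro γ h0 hγ heq
    obtain ⟨M, hM, hML, -, hg⟩ := hform γ hγ
    obtain ⟨N, hN, -, hNR, hg'⟩ := hform (-γ) (by rwa [abs_neg])
    rw [hg, hg', ← hM, ← hN, Real.cos_neg, Real.sin_neg, hML h0, hNR (by linarith),
      add_right_inj, neg_smul, ← smul_neg] at heq
    rw [abs_of_pos h0] at hγ
    have hsin := (Real.sin_pos_of_pos_of_lt_pi h0 (hγ.trans h.lt_pi)).ne'
    exact hne (smul_right_injective Space hsin heq).symm
  rcases abs_eq_abs.1 habs with h1 | h1
  · exact h1
  · rcases lt_trichotomy β 0 with h0 | h0 | h0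
    · refine absurd he.symm ?_
      have := aux (-β) (by linarith) (by rwa [abs_neg])
      rwa [neg_neg, ← h1] at this
    · rw [h1, h0, neg_zero]
    · refine absurd he ?_
      rw [h1]
      exact aux β h0 hβ

lemma continuous_rot3_mul (ha : Continuous a) (e : Fin 3 → ℝ) (x : Space) :
    Continuous fun σ => rot3 u (e * a σ) x :=
  continuous_rot3 u (by fun_prop) continuous_const

/-- Bending by small angles keeps the folding injective. -/
lemma IsHinges.eventually_injective (hh : IsHinges C f b c' s u) (hf : IsConeFolding C f)
    (hC : C.Finite) (ha : Continuous a) (ha0 : a 0 = 0)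
    (hfix : ∀ σ, rot3 u (a σ) (f c') = f c') :
    ∀ᶠ σ in 𝓝 (0 : ℝ), Function.Injective (bend f b s u (a σ)) := by
  have hu := hh.norm_axis hf
  have hcont := hh.continuous_bend hf hC ha hfix
  have hK : IsCompact (Metric.sphere (0 : ℂ) 1 ×ˢ Metric.sphere (0 : ℂ) 1) :=
    (isCompact_sphere _ _).prod (isCompact_sphere _ _)
  have hev : ∀ᶠ σ in 𝓝 (0 : ℝ), ∀ p ∈ Metric.sphere (0 : ℂ) 1 ×ˢ Metric.sphere (0 : ℂ) 1,
      ‖p.1‖ = 1 → ‖p.2‖ = 1 → bend f b s u (a σ) p.1 = bend f b s u (a σ) p.2 → p.1 = p.2 := by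
    -- By compactness it suffices to work near each pair of unit vectors: on the diagonal by local
    -- injectivity, which is stable because the two sides stay apart, and off the diagonal by
    -- continuity from `σ = 0`.
    refine hK.eventually_forall_of_forall_eventually ?_
    rintro ⟨x, y⟩ ⟨hx, hy⟩
    rw [mem_sphere_zero_iff_norm] at hx hy
    rcases eq_or_ne x y with rfl | hxy
    · have hx0 : x ≠ 0 := norm_ne_zero_iff.1 (by rw [hx]; exact one_ne_zero)
      obtain ⟨c, hc⟩ := exists_eq_norm_mul x
      obtain ⟨δ, L, R, hs, -⟩ := hf.exists_hasSides hC c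
      obtain ⟨ε, e, e', hb⟩ := hh.exists_hasSides_bend hf hu hs
      have hε := (hb (a 0) (hfix 0)).pos
      have hne : ∀ᶠ σ in 𝓝 (0 : ℝ), rot3 u (e * a σ) (L (Complex.I * c)) ≠
          -rot3 u (e' * a σ) (R (Complex.I * c)) := by
        refine (isOpen_ne_fun (continuous_rot3_mul ha e (L (Complex.I * c)))
          (continuous_rot3_mul ha e' (R (Complex.I * c))).neg).mem_nhds ?_
        rw [Set.mem_ofPred_eq, Pi.neg_apply]
        simp only [ha0, mul_zero, rot3_zero]
        exact hf.sides_ne_neg hs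
      have h1 : ∀ᶠ z : ℝ × ℂ × ℂ in 𝓝 (0, x, x), |Complex.arg (z.2.1 / c)| < ε :=
        ((by fun_prop : Continuous fun z : ℝ × ℂ × ℂ => z.2.1).tendsto (0, x, x)).eventually
          (eventually_abs_arg_lt hx0 hc hε)
      have h2 : ∀ᶠ z : ℝ × ℂ × ℂ in 𝓝 (0, x, x), |Complex.arg (z.2.2 / c)| < ε :=
        ((by fun_prop : Continuous fun z : ℝ × ℂ × ℂ => z.2.2).tendsto (0, x, x)).eventually
          (eventually_abs_arg_lt hx0 hc hε)
      filter_upwards [h1, h2, continuousAt_fst.eventually hne] with z hz1 hz2 hz3 hn1 hn2 heq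
      have e1 := eq_polarPoint c z.2.1
      have e2 := eq_polarPoint c z.2.2
      rw [hn1] at e1
      rw [hn2] at e2
      rw [e1, e2] at heq
      rw [e1, e2, (hb (a z.1) (hfix z.1)).eq_of_eq hz3 hz1 hz2 heq]
    · have h1 : Continuous fun z : ℝ × ℂ × ℂ => bend f b s u (a z.1) z.2.1 :=
        hcont.comp (f := fun z : ℝ × ℂ × ℂ => (z.1, z.2.1)) (by fun_prop)
      have h2 : Continuous fun z : ℝ × ℂ × ℂ => bend f b s u (a z.1) z.2.2 :=
        hcont.comp (f := fun z : ℝ × ℂ × ℂ => (z.1, z.2.2)) (by fun_prop)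
      have hne : ∀ᶠ z : ℝ × ℂ × ℂ in 𝓝 (0, x, y),
          bend f b s u (a z.1) z.2.1 ≠ bend f b s u (a z.1) z.2.2 := by
        refine (isOpen_ne_fun h1 h2).mem_nhds ?_
        rw [Set.mem_ofPred_eq]
        simp only [ha0, bend_zero]
        exact fun h => hxy (hf.injOn trivial trivial h)
      filter_upwards [hne] with z hz _ _ heq using absurd heq hz
  filter_upwards [hev] with σ hσ x y hxy
  have hn : ‖x‖ = ‖y‖ := by rw [← norm_bend hf hu (a σ) x, hxy, norm_bend hf hu]
  rcases eq_or_ne x 0 with rfl | hx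
  · rw [norm_zero] at hn; exact (norm_eq_zero.1 hn.symm).symm
  have hpos : 0 < ‖x‖⁻¹ := inv_pos.2 (norm_pos_iff.2 hx)
  have hx1 : ‖(‖x‖⁻¹ • x)‖ = 1 := by
    rw [norm_smul, norm_inv, norm_norm, inv_mul_cancel₀ (norm_ne_zero_iff.2 hx)]
  have hy1 : ‖(‖x‖⁻¹ • y)‖ = 1 := by
    rw [norm_smul, ← hn, norm_inv, norm_norm, inv_mul_cancel₀ (norm_ne_zero_iff.2 hx)]
  exact smul_right_injective ℂ hpos.ne' (hσ (‖x‖⁻¹ • x, ‖x‖⁻¹ • y)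
    ⟨mem_sphere_zero_iff_norm.2 hx1, mem_sphere_zero_iff_norm.2 hy1⟩ hx1 hy1
    (by simp only [bend_smul hf _ hpos, hxy]))

lemma IsHinges.isRigidFolding_bend (hh : IsHinges C f b c' s u) (hf : IsConeFolding C f)
    (hC : C.Finite) (ha : Continuous a) (hfix : ∀ σ, rot3 u (a σ) (f c') = f c') {σ : ℝ}
    (hinj : Function.Injective (bend f b s u (a σ))) :
    IsRigidFolding Set.univ (insert c' C) (bend f b s u (a σ)) where
  continuousOn := ((hh.continuous_bend hf hC ha hfix).comp
    (f := fun x : ℂ => (σ, x)) (by fun_prop)).continuousOn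
  injOn := hinj.injOn
  isometry_face := by
    rintro S ⟨z, hz, rfl⟩ x hx y hy
    exact hh.dist_bend hf isPreconnected_connectedComponentIn (connectedComponentIn_subset _ _)
      _ hx hy

lemma HasSides.exists_angle_of_det {g : ℂ → Space} {c : Circle} {δ : ℝ} {L R : ℂ →ₗᵢ[ℝ] Space}
    (h : HasSides g c δ L R) {m : MV}
    (hm : m.Allows (det3 (R c) (R (Complex.I * c)) (L (Complex.I * c)))) :
    ∃ θ, HasFoldingAngle Set.univ g c θ ∧ m.Allows θ := by
  obtain ⟨θ, hθ, hsin, -⟩ := h.exists_hasFoldingAngle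
  refine ⟨θ, hθ, ?_⟩
  obtain ⟨-, -, -, h1, h2, -⟩ := hθ
  rw [← hsin] at hm
  cases m with
  | mountain =>
    change θ < 0
    by_contra! h0
    exact absurd hm (not_lt.2 (Real.sin_nonneg_of_nonneg_of_le_pi h0 h2))
  | valley =>
    change 0 < θ
    by_contra! h0
    exact absurd hm (not_lt.2 (Real.sin_nonpos_of_nonpos_of_neg_pi_le h0 h1.le))

/-- Bending by small angles keeps the sign of the folding angle at a crease. -/
lemma IsHinges.eventually_angle (hh : IsHinges C f b c' s u) (hf : IsConeFolding C f)
    (ha : Continuous a) (ha0 : a 0 = 0) (hfix : ∀ σ, rot3 u (a σ) (f c') = f c')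
    {c : Circle} {δ : ℝ} {L R : ℂ →ₗᵢ[ℝ] Space} (hs : HasSides f c δ L R) {m : MV}
    (hm : m.Allows (det3 (R c) (R (Complex.I * c)) (L (Complex.I * c)))) :
    ∀ᶠ σ in 𝓝 (0 : ℝ), ∃ θ, HasFoldingAngle Set.univ (bend f b s u (a σ)) c θ ∧ m.Allows θ := by
  have hu := hh.norm_axis hf
  obtain ⟨ε, e, e', hb⟩ := hh.exists_hasSides_bend hf hu hs
  have hcont : Continuous fun σ => det3 (rot3 u (e' * a σ) (R c))
      (rot3 u (e' * a σ) (R (Complex.I * c))) (rot3 u (e * a σ) (L (Complex.I * c))) :=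
    continuous_det3 (continuous_rot3_mul ha _ _) (continuous_rot3_mul ha _ _)
      (continuous_rot3_mul ha _ _)
  have hev : ∀ᶠ σ in 𝓝 (0 : ℝ), m.Allows (det3 (rot3 u (e' * a σ) (R c))
      (rot3 u (e' * a σ) (R (Complex.I * c))) (rot3 u (e * a σ) (L (Complex.I * c)))) := by
    cases m with
    | mountain =>
      refine hcont.continuousAt.eventually (gt_mem_nhds ?_)
      simp only [ha0, mul_zero, rot3_zero]
      exact hm
    | valley =>
      refine hcont.continuousAt.eventually (lt_mem_nhds ?_)
      simp only [ha0, mul_zero, rot3_zero]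
      exact hm
  filter_upwards [hev] with σ hσ
  exact (hb (a σ) (hfix σ)).exists_angle_of_det hσ

lemma MV.exists_sign (m : MV) : ∃ k : ℝ, (k = 1 ∨ k = -1) ∧ ∀ x : ℝ, 0 < k * x ↔ m.Allows x := by
  cases m with
  | mountain => exact ⟨-1, Or.inr rfl, fun x => by simp [MV.Allows]⟩
  | valley => exact ⟨1, Or.inl rfl, fun x => by simp [MV.Allows]⟩

end Bend

/-! ### The deformation and the two statements. -/

/-- Angles are measured from the direction opposite to `c'`, which puts the cut at `π`; no hinge
lies there since `c'` is not a crease. Independence makes the three angles distinct, and sorting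
puts the hinges in order. -/
lemma exists_isHinges {C : Set Circle} {f : ℂ → Space}
    {c' : Circle} (hc' : c' ∉ C) {c : Fin 3 → Circle} (hc : ∀ i, c i ∈ C)
    (hli : LinearIndependent ℝ fun i => f (c i)) :
    ∃ b s u, IsHinges C f b c' s u ∧ LinearIndependent ℝ u := by
  let b := Circle.exp Real.pi * c'
  have hopp : Circle.exp Real.pi * b = c' := by
    rw [← mul_assoc, ← Circle.exp_add, ← two_mul, Circle.exp_two_pi, one_mul]
  choose t h1 h2 ht using fun i => exists_exp_mul_eq b (c i)
  have hinj : Function.Injective t := fun i j hij => hli.injective (by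
    simp only [← ht, hij])
  refine ⟨b, t ∘ Tuple.sort t, fun i => f (c (Tuple.sort t i)), ⟨hopp,
    (Tuple.monotone_sort t).strictMono_of_injective (hinj.comp (Equiv.injective _)),
    fun i => h1 _, fun i => lt_of_le_of_ne (h2 _) fun h => ?_, fun i => ?_, fun i => ?_⟩,
    hli.comp _ (Equiv.injective _)⟩
  · refine hc' ?_
    rw [← hopp, ← h, Function.comp_apply, ht]
    exact hc _
  · rw [Function.comp_apply, ht]
    exact hc _
  · rw [Function.comp_apply, ht]

/-- A folded state can be deformed so that a further crease is folded in a prescribed way. -/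
theorem IsConeFolding.exists_deformation {C : Set Circle} {f : ℂ → Space} (hf : IsConeFolding C f)
    (hC : C.Finite) (hcard : 2 < C.ncard) {c' : Circle} (hc' : c' ∉ C) {μ ν : Circle → MV}
    (hν : ∀ c ∈ C, ν c = μ c) (hfold : IsFoldedAs Set.univ C μ f) :
    ∃ G : ℝ → ℂ → Space, Continuous (fun p : ℝ × ℂ => G p.1 p.2) ∧ G 0 = f ∧
      (∀ t ∈ Set.Icc (0 : ℝ) 1, IsRigidFolding Set.univ (insert c' C) (G t)) ∧
      IsFoldedAs Set.univ (insert c' C) ν (G 1) := by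
  have hsides : ∀ c ∈ C, ∃ δ L R, HasSides f c δ L R ∧
      (ν c).Allows (det3 (R c) (R (Complex.I * c)) (L (Complex.I * c))) := by
    intro c hc
    obtain ⟨δ, L, R, hs, -⟩ := hf.exists_hasSides hC c
    obtain ⟨θ, hθ, hμ⟩ := hfold c hc
    obtain ⟨h1, h2⟩ := hf.sign_det_of_hasFoldingAngle hs hθ
    refine ⟨δ, L, R, hs, ?_⟩
    rw [hν c hc]
    revert hμ
    cases μ c with
    | mountain => exact h2
    | valley => exact h1
  obtain ⟨c, hc, hli⟩ := hf.exists_independent_creases hC hcard fun c hc => by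
    obtain ⟨δ, L, R, hs, h⟩ := hsides c hc
    refine ⟨δ, L, R, hs, fun h0 => ?_⟩
    rw [h0] at h
    revert h
    cases ν c <;> exact lt_irrefl _
  obtain ⟨b, s, u, hh, hu⟩ := exists_isHinges hc' hc hli
  have hu1 := hh.norm_axis hf
  obtain ⟨δ, L, R, hs, hLR⟩ := hf.exists_hasSides hC c'
  -- Since `c'` is not yet a crease, `f` is given by one linear map on both of its sides.
  obtain rfl := hLR hc'
  have hv : ‖L c'‖ = 1 := by rw [L.norm_map, Circle.norm_coe]
  have hn : ‖L (Complex.I * c')‖ = 1 := by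
    rw [L.norm_map, norm_mul, Complex.norm_I, Circle.norm_coe, one_mul]
  obtain ⟨a, ha, ha0, hclose⟩ := exists_closing hu hu1 hv hn
    (by rw [L.inner_map_map, inner_circle_I_mul])
  have hfix : ∀ σ, rot3 u (a σ) (f c') = f c' := fun σ => by
    rw [hs.eq_left]; exact (hclose σ).1
  have hev : ∀ᶠ σ in 𝓝 (0 : ℝ), ∀ c ∈ C, ∃ θ,
      HasFoldingAngle Set.univ (bend f b s u (a σ)) c θ ∧ (ν c).Allows θ := by
    refine (Filter.eventually_all_finite hC).2 fun c hc => ?_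
    obtain ⟨δ, L, R, hs, h⟩ := hsides c hc
    exact hh.eventually_angle hf ha ha0 hfix hs h
  obtain ⟨η, hη, hball⟩ := Metric.eventually_nhds_iff.1
    (hev.and (hh.eventually_injective hf hC ha ha0 hfix))
  obtain ⟨k, hk, hsign⟩ := (ν c').exists_sign
  have hsmall : ∀ t ∈ Set.Icc (0 : ℝ) 1, dist (-k * (η / 2) * t) 0 < η := by
    intro t ht
    have : |k| = 1 := by rcases hk with rfl | rfl <;> simp
    rw [Real.dist_eq, sub_zero, abs_mul, abs_mul, abs_neg, this, abs_of_pos (half_pos hη),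
      abs_of_nonneg ht.1]
    nlinarith [ht.1, ht.2]
  -- The minus sign occurs because the clockwise side of `c'` is the one that turns: with `v = L c'`
  -- and `n = L (Complex.I * c')`, the determinant at `c'` is that of `v`, `rot3 u θ n`, `n`, which
  -- is minus the sine controlled by `exists_closing`.
  refine ⟨fun t => bend f b s u (a (-k * (η / 2) * t)), ?_, ?_, fun t ht => ?_, ?_⟩
  · exact (hh.continuous_bend hf hC ha hfix).comp
      (f := fun p : ℝ × ℂ => (-k * (η / 2) * p.1, p.2)) (by fun_prop)
  · funext x
    simp only [mul_zero, ha0, bend_zero]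
  · exact hh.isRigidFolding_bend hf hC ha hfix (hball (hsmall t ht)).2
  · rintro d (rfl | hd)
    · obtain ⟨ε, hb⟩ := hh.hasSides_bend_opposite hf hu1 hs
      refine (hb _ (hfix _)).exists_angle_of_det ((hsign _).1 ?_)
      obtain ⟨h1, h2, h3⟩ := hclose (-k * (η / 2) * 1)
      rw [rot3Isometry_comp_apply, rot3Isometry_comp_apply, h1, det3_eq,
        inner_cross_rotate, inner_cross_swap, real_inner_comm]
      rcases hk with rfl | rfl
      · have := h3 (by linarith)
        linarith
      · have := h2 (by linarith)
        linarith
    · exact (hball (hsmall 1 (by simp))).1 d hd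

lemma IsFoldedAs.cone {A : Set ℂ} {C : Set Circle} {f : ℂ → Space} {μ : Circle → MV}
    (h : IsFoldedAs A C μ f) (hf : IsRigidFolding A C f) (hC : C.Finite) {ρ : ℝ} (hρ : 0 < ρ)
    (hA : Metric.closedBall 0 ρ ⊆ A) : IsFoldedAs Set.univ C μ (cone ρ f) := fun c hc => by
  obtain ⟨θ, hθ, hμ⟩ := h c hc
  exact ⟨θ, hθ.cone hf hC hρ hA, hμ⟩

lemma IsFoldedAs.restrict {C : Set Circle} {f : ℂ → Space} {μ : Circle → MV}
    (h : IsFoldedAs Set.univ C μ f) (A : Set ℂ) : IsFoldedAs A C μ f := fun c hc => by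
  obtain ⟨θ, hθ, hμ⟩ := h c hc
  exact ⟨θ, hθ.restrict A, hμ⟩

/-- Adding a crease, possibly unfolded, to a rigid folding. -/
lemma IsRigidFolding.mono {A : Set ℂ} {C D : Set Circle} {f : ℂ → Space}
    (hf : IsRigidFolding A C f) (hCD : C ⊆ D) : IsRigidFolding A D f where
  continuousOn := hf.continuousOn
  injOn := hf.injOn
  isometry_face := by
    rintro S ⟨z, hz, rfl⟩ x hx y hy
    exact hf.dist_eq_of_isPreconnected isPreconnected_connectedComponentIn
      ((connectedComponentIn_subset _ _).trans
        (Set.sdiff_subset_sdiff_right (Set.biUnion_subset_biUnion_left hCD))) hx hy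

lemma IsConeFolding.hasFoldingAngle_zero {C : Set Circle} {f : ℂ → Space}
    (hf : IsConeFolding C f) (hC : C.Finite) {c : Circle} (hc : c ∉ C) :
    HasFoldingAngle Set.univ f c 0 := by
  obtain ⟨δ, L, R, hs, hLR⟩ := hf.exists_hasSides hC c
  obtain ⟨θ, hθ, -, h0⟩ := hs.exists_hasFoldingAngle
  rwa [h0 (hLR hc)] at hθ

theorem RigidlyFoldable.insert {A : Set ℂ} (hA : A ∈ nhds (0 : ℂ)) {C : Set Circle}
    (hC : C.Finite) (hcard : 2 < C.ncard) {c' : Circle} (hc' : c' ∉ C) {μ ν : Circle → MV}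
    (hν : ∀ c ∈ C, ν c = μ c) (h : RigidlyFoldable A C μ) :
    RigidlyFoldable A (insert c' C) ν := by
  obtain ⟨ρ, hρ, hball⟩ := Metric.nhds_basis_closedBall.mem_iff.1 hA
  obtain ⟨f, hf, hfold⟩ := h
  obtain ⟨G, -, -, hG, hG1⟩ := (hf.cone hC hρ hball).exists_deformation hC hcard hc' hν
    (hfold.cone hf hC hρ hball)
  exact ⟨G 1, IsRigidFolding.restrict (hG 1 (by simp)) A, hG1.restrict A⟩

theorem ContinuouslyRigidlyFoldable.insert {A : Set ℂ} (hA : A ∈ nhds (0 : ℂ)) {C : Set Circle}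
    (hC : C.Finite) (hcard : 2 < C.ncard) {c' : Circle} (hc' : c' ∉ C) {μ ν : Circle → MV}
    (hν : ∀ c ∈ C, ν c = μ c) (h : ContinuouslyRigidlyFoldable A C μ) :
    ContinuouslyRigidlyFoldable A (insert c' C) ν := by
  obtain ⟨ρ, hρ, hball⟩ := Metric.nhds_basis_closedBall.mem_iff.1 hA
  obtain ⟨F, hF, hrig, hflat, hfold⟩ := h
  have hcone : ∀ t ∈ Set.Icc (0 : ℝ) 1, IsConeFolding C (cone ρ (F t)) := fun t ht =>
    (hrig t ht).cone hC hρ hball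
  obtain ⟨G, hGc, hG0, hG, hG1⟩ := (hcone 1 (by simp)).exists_deformation hC hcard hc' hν
    (hfold.cone (hrig 1 (by simp)) hC hρ hball)
  -- Concatenation written as a sum: in the first half the bracket vanishes, and in the second the
  -- first term is constantly `G 0`. Continuity then needs no gluing.
  let H : ℝ → ℂ → Space := fun t x =>
    cone ρ (F (min (2 * t) 1)) x + (G (max (2 * t - 1) 0) x - G 0 x)
  have hfirst : ∀ t, t ≤ 1 / 2 → H t = cone ρ (F (2 * t)) := by
    intro t ht
    funext x
    simp only [H]
    rw [min_eq_left (by linarith), max_eq_right (by linarith), sub_self, add_zero]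
  have hsecond : ∀ t, 1 / 2 ≤ t → H t = G (2 * t - 1) := by
    intro t ht
    funext x
    simp only [H]
    rw [min_eq_right (by linarith), max_eq_left (by linarith), hG0, add_sub_cancel]
  refine ⟨H, ?_, fun t ht => ?_, ?_, ?_⟩
  · have h1 : ContinuousOn (fun p : ℝ × ℂ => cone ρ (F (min (2 * p.1) 1)) p.2)
        (Set.Icc (0 : ℝ) 1 ×ˢ A) := by
      refine (continuousOn_cone hF hrig hC hρ hball).comp
        (f := fun p : ℝ × ℂ => (min (2 * p.1) 1, p.2)) (by fun_prop) fun p hp => ⟨⟨?_, ?_⟩, trivial⟩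
      · exact le_min (by linarith [hp.1.1]) zero_le_one
      · exact min_le_right _ _
    have h2 : Continuous fun p : ℝ × ℂ => G (max (2 * p.1 - 1) 0) p.2 :=
      hGc.comp (f := fun p : ℝ × ℂ => (max (2 * p.1 - 1) 0, p.2)) (by fun_prop)
    have h3 : Continuous fun p : ℝ × ℂ => G 0 p.2 :=
      hGc.comp (f := fun p : ℝ × ℂ => (0, p.2)) (by fun_prop)
    exact h1.add (h2.sub h3).continuousOn
  · rcases le_total t (1 / 2) with h | h
    · rw [hfirst t h]
      exact IsRigidFolding.restrict ((hcone (2 * t) ⟨by linarith [ht.1], by linarith⟩).mono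
        (Set.subset_insert _ _)) A
    · rw [hsecond t h]
      exact IsRigidFolding.restrict (hG _ ⟨by linarith, by linarith [ht.2]⟩) A
  · rw [hfirst 0 (by norm_num), mul_zero]
    rintro c (rfl | hc)
    · exact ((hcone 0 (by simp)).hasFoldingAngle_zero hC hc').restrict A
    · exact ((hflat c hc).cone (hrig 0 (by simp)) hC hρ hball).restrict A
  · rw [hsecond 1 (by norm_num), show (2 : ℝ) * 1 - 1 = 1 by norm_num]
    exact hG1.restrict A

end Origami

theorem lemma2 (A : Set ℂ) (hA : A ∈ nhds (0 : ℂ)) (hstar : StarConvex ℝ (0 : ℂ) A)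
    (C : Set Circle) (hfin : C.Finite) (hcard : 2 < C.ncard)
    (c' : Circle) (hc' : c' ∉ C)
    (μ ν : Circle → Origami.MV) (hν : ∀ c ∈ C, ν c = μ c) :
    (Origami.ContinuouslyRigidlyFoldable A C μ →
      Origami.ContinuouslyRigidlyFoldable A (insert c' C) ν) ∧
    (Origami.RigidlyFoldable A C μ → Origami.RigidlyFoldable A (insert c' C) ν) :=
  ⟨fun h => h.insert hA hfin hcard hc' hν, fun h => h.insert hA hfin hcard hc' hν⟩
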